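/- Let $E$ be a finite set, $V=\mathbb{C}^E$, and let $W\subseteq V$ be any linear subspace (a configuration over $\mathbb{C}$). Let $\mathsf{M}$ be the matroid on $E$ whose bases are the subsets $B\subseteq E$ for which the coordinate projection $\mathbb{C}^E\to\mathbb{C}^B$ restricts to an isomorphism on $W$. Let $\Lambda_W\subseteq\mathbb{P}V\times\mathbb{P}V^\star$ be Bloch's incidence variety $$\Lambda_W=\Big\{([w],[\beta]) \;\Big|\; 0\neq w\in W,\ 0\neq\beta\in V^\star,\ \sum_{i\in E}\beta_iw_iu_i=0\text{ for all }u\in W\Big\}.$$ Let $\mathbb{L}=[\mathbb{A}^1]$ be the class of the affine line in the Grothendieck ring of varieties over $\mathbb{C}$. For a matroid $\mathsf{N}$ with nonempty ground set $S$, let $\chi_{\mathsf{N}}(t)=\sum_{A\subseteq S}(-1)^{|A|}t^{\operatorname{rk}\mathsf{N}-\operatorname{rk}_{\mathsf{N}}A}$ be its characteristic polynomial and $\overline{\chi}_{\mathsf{N}}(t)=\chi_{\mathsf{N}}(t)/(t-1)\in\mathbb{Z}[t]$ its reduced characteristic polynomial. Then, in the Grothendieck ring of varieties over $\mathbb{C}$,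 $$[\Lambda_W]=\sum_{F}\overline{\chi}_{\mathsf{M}/F}(\mathbb{L})\cdot\frac{\mathbb{L}^{|E|-\operatorname{rk}(\mathsf{M}\setminus F)}-1}{\mathbb{L}-1},$$ where $F$ runs over the flats of $\mathsf{M}$ with $F\neq E$, and $(\mathbb{L}^m-1)/(\mathbb{L}-1)$ stands for the value at $\mathbb{L}$ of the polynomial $(t^m-1)/(t-1)=1+t+\dots+t^{m-1}$. In particular, $[\Lambda_W]$ is a polynomial in $\mathbb{L}$ with integer coefficients. -/

import Mathlib

open CategoryTheory AlgebraicGeometry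
open scoped Polynomial

noncomputable section

/-! ### The Grothendieck ring of varieties -/

namespace GrothendieckRing

/-- The property of a `K`-scheme of being a variety: separated and of finite type over `K`. -/
def isVariety (K : Type) [Field K] : ObjectProperty (Over (Spec (.of K))) := fun X =>
  LocallyOfFiniteType X.hom ∧ QuasiCompact X.hom ∧ IsSeparated X.hom

instance isVariety_isMonoidal (K : Type) [Field K] : (isVariety K).IsMonoidal where
  prop_unit := by
    refine ⟨?_, ?_, ?_⟩ <;> (dsimp; infer_instance)
  prop_tensor X Y hX hY := by
    obtain ⟨_, _, _⟩ := hX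
    obtain ⟨_, _, _⟩ := hY
    refine ⟨?_, ?_, ?_⟩ <;> (rw [Over.tensorObj_hom]; infer_instance)

/-- The category of varieties over `K`. Its monoidal structure is the fibre product over `K`. -/
abbrev Var (K : Type) [Field K] := (isVariety K).FullSubcategory

/-- The free abelian group on the isomorphism classes of varieties over `K`, with the
multiplication given by `[X] * [Y] = [X × Y]` and the unit `[Spec K]`. -/
abbrev IsoClassRing (K : Type) [Field K] : Type 1 := MonoidAlgebra ℤ (Skeleton (Var K))

/-- The basis element of a variety. -/
def IsoClassRing.of {K : Type} [Field K] (X : Var K) : IsoClassRing K :=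
  MonoidAlgebra.of ℤ (Skeleton (Var K)) (toSkeleton X)

/-- The ideal generated by the scissor relations `[X] = [Z] + [U]`, for `Z` a closed subvariety
of `X` and `U` its open complement. -/
def scissorIdeal (K : Type) [Field K] : Ideal (IsoClassRing K) :=
  Ideal.span {a | ∃ (X Z U : Var K) (i : Z ⟶ X) (j : U ⟶ X),
    IsClosedImmersion i.hom.left ∧ IsOpenImmersion j.hom.left ∧
    Set.range j.hom.left = (Set.range i.hom.left)ᶜ ∧
    a = IsoClassRing.of X - (IsoClassRing.of Z + IsoClassRing.of U)}

/-- The Grothendieck ring of varieties over `K`. -/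
abbrev K₀Var (K : Type) [Field K] : Type 1 := IsoClassRing K ⧸ scissorIdeal K

/-- The class in the Grothendieck ring of the `K`-variety with structure morphism `f`. -/
def cls {K : Type} [Field K] {X : Scheme.{0}} (f : X ⟶ Spec (.of K))
    [h₁ : LocallyOfFiniteType f] [h₂ : QuasiCompact f] [h₃ : IsSeparated f] : K₀Var K :=
  Ideal.Quotient.mk (scissorIdeal K) (IsoClassRing.of ⟨Over.mk f, h₁, h₂, h₃⟩)

/-- The class `𝕃` of the affine line. -/
def lefschetz (K : Type) [Field K] : K₀Var K :=
  cls (𝔸(PUnit; Spec (.of K)) ↘ Spec (.of K))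

end GrothendieckRing

/-! ### Matroids -/

namespace Matroid

/-- The proper flats of a matroid on a finite type. -/
def properFlats {α : Type*} [Finite α] (M : Matroid α) : Finset (Set α) :=
  (Set.toFinite {F : Set α | M.IsFlat F ∧ F ≠ M.E}).toFinset

/-- The characteristic polynomial `χ_M(t) = ∑_{A ⊆ E} (-1)^|A| t^(rk M - rk A)`. -/
def charPoly {α : Type*} [Finite α] (M : Matroid α) : ℤ[X] :=
  ∑ A ∈ (Set.toFinite M.E).toFinset.powerset,
    (-1) ^ A.card * Polynomial.X ^ (M.eRank.toNat - (M.eRk (A : Set α)).toNat)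

/-- The reduced characteristic polynomial `χ_M(t) / (t - 1)`. The division is exact whenever the
ground set is nonempty, see `Matroid.X_sub_one_mul_reducedCharPoly`. -/
def reducedCharPoly {α : Type*} [Finite α] (M : Matroid α) : ℤ[X] :=
  M.charPoly /ₘ (Polynomial.X - Polynomial.C 1)

theorem X_sub_one_mul_reducedCharPoly {α : Type*} [Finite α] (M : Matroid α)
    (hM : M.E.Nonempty) :
    (Polynomial.X - Polynomial.C 1) * M.reducedCharPoly = M.charPoly := by
  rw [reducedCharPoly, Polynomial.mul_divByMonic_eq_iff_isRoot, Polynomial.IsRoot, charPoly,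
    Polynomial.eval_finsetSum]
  have h : (Set.toFinite M.E).toFinset.Nonempty := by simpa using hM
  simpa using Finset.sum_powerset_neg_one_pow_card_of_nonempty h

end Matroid

/-! ### Configurations -/

namespace Configuration

section matroid

variable {E K : Type} [Fintype E] [Field K]

/-- The `i`-th coordinate function `ℓ_i` on a subspace `W` of `K^E`. -/
def coordFn (W : Submodule K (E → K)) (i : E) : Module.Dual K W :=
  (LinearMap.proj i).domRestrict W

/-- The matroid of a configuration `W ⊆ K^E`: its independent sets are the `I ⊆ E` for which the
coordinate functions `ℓ_i`, `i ∈ I`, are linearly independent on `W`. -/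
def matroid (W : Submodule K (E → K)) : Matroid E :=
  (IndepMatroid.ofFinite (E := Set.univ) (Set.toFinite _)
    (fun I => LinearIndepOn K (coordFn W) I)
    (linearIndepOn_empty K _)
    (fun _ _ hJ hIJ => hJ.mono hIJ)
    (fun I J hI hJ hIJ => by
      by_contra! hcon
      have hsub : coordFn W '' J ⊆ Submodule.span K (coordFn W '' I) := by
        rintro _ ⟨e, he, rfl⟩
        by_cases heI : e ∈ I
        · exact Submodule.subset_span ⟨e, heI, rfl⟩
        · by_contra hn
          exact hcon e he heI (hI.insert hn)
      have h1 := Submodule.finrank_mono (Submodule.span_le.2 hsub)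
      have key : ∀ S : Set E, LinearIndepOn K (coordFn W) S →
          Module.finrank K (Submodule.span K (coordFn W '' S)) = S.ncard := by
        intro S hS
        have := Fintype.ofFinite S
        have := finrank_span_eq_card (b := fun i : S => coordFn W i) hS
        rw [Set.image_eq_range, this, Fintype.card_eq_nat_card, Nat.card_coe_set_eq]
      rw [key J hJ, key I hI] at h1
      omega)
    (fun _ _ => Set.subset_univ _)).matroid

/-- The bases of the matroid are the sets `B` for which the coordinate projection `K^E → K^B`
restricts to an isomorphism on `W`. -/
theorem matroid_isBase_iff (W : Submodule K (E → K)) (B : Set E) :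
    (matroid W).IsBase B ↔ Function.Bijective (fun (w : W) (i : B) => (w : E → K) i) := by
  have hproj : ∀ S : Set E, LinearIndepOn K (coordFn W) S ↔
      Function.Surjective (LinearMap.pi fun i : S => coordFn W i) := by
    intro S
    classical
    have := Fintype.ofFinite S
    have hd : ∀ f : Module.Dual K (S → K),
        (LinearMap.pi fun i : S => coordFn W i).dualMap f =
          ∑ i, f (Pi.single i 1) • coordFn W i := by
      intro f
      ext w
      rw [LinearMap.dualMap_apply, LinearMap.pi_apply_eq_sum_univ f]
      have h1 : ∀ i : S, (fun j => if i = j then 1 else 0 : S → K) = Pi.single i 1 := fun i => by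
        ext j
        simp [Pi.single_apply, eq_comm]
      simp [mul_comm, h1]
    rw [← LinearMap.dualMap_injective_iff, LinearIndepOn, Fintype.linearIndependent_iff,
      injective_iff_map_eq_zero]
    constructor
    · intro h f hf
      rw [hd] at hf
      refine LinearMap.pi_ext' fun i => LinearMap.ext_ring ?_
      simpa using h _ hf i
    · intro h c hc i
      have h0 := h (∑ j, c j • LinearMap.proj j) (by
        rw [hd, ← hc]
        refine Finset.sum_congr rfl fun j _ => ?_
        simp [Pi.single_apply])
      simpa [Pi.single_apply] using LinearMap.congr_fun h0 (Pi.single i 1)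
  have hindep : ∀ S : Set E, (matroid W).Indep S ↔ LinearIndepOn K (coordFn W) S := fun _ => Iff.rfl
  constructor
  · intro hB
    have hBi := (hindep B).1 hB.indep
    refine ⟨?_, (hproj B).1 hBi⟩
    intro w w' hw
    have hw : ∀ i ∈ B, coordFn W i w = coordFn W i w' := fun i hi => congr_fun hw ⟨i, hi⟩
    ext e
    change coordFn W e w = coordFn W e w'
    by_cases he : e ∈ B
    · exact hw e he
    have hmem : coordFn W e ∈ Submodule.span K (coordFn W '' B) := by
      by_contra hn
      have h1 : (matroid W).Indep (insert e B) := (hindep _).2 (hBi.insert hn)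
      exact he (hB.eq_of_subset_indep h1 (Set.subset_insert e B) ▸ Set.mem_insert e B)
    have hle : Submodule.span K (coordFn W '' B) ≤
        LinearMap.ker (Module.Dual.eval K W (w - w')) := by
      rw [Submodule.span_le]
      rintro _ ⟨i, hi, rfl⟩
      simp [hw i hi]
    simpa [sub_eq_zero] using hle hmem
  · rintro ⟨hinj, hsurj⟩
    rw [Matroid.isBase_iff_maximal_indep]
    refine ⟨(hindep B).2 ((hproj B).2 hsurj), ?_⟩
    intro J hJ hBJ e he
    by_contra heB
    classical
    obtain ⟨w, hw⟩ := (hproj J).1 ((hindep J).1 hJ) (Pi.single ⟨e, he⟩ 1)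
    have hw0 : w = 0 := by
      apply hinj
      funext i
      have h1 := congr_fun hw ⟨i, hBJ i.2⟩
      have hne : (⟨i, hBJ i.2⟩ : J) ≠ ⟨e, he⟩ := fun h => heB (by
        rw [← show (i : E) = e from congrArg Subtype.val h]; exact i.2)
      rw [Pi.single_eq_of_ne hne] at h1
      exact h1
    have h1 := congr_fun hw ⟨e, he⟩
    simp [hw0] at h1

end matroid

section scheme

attribute [local instance] MvPolynomial.gradedAlgebra

variable (E K : Type) [Field K]

/-- The projective space `ℙ(K^E)` of lines in `K^E`, with homogeneous coordinates indexed
by `E`. -/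
abbrev projSpace : Scheme.{0} := Proj (MvPolynomial.homogeneousSubmodule E K)

/-- The structure morphism of projective space. -/
def projSpaceHom : projSpace E K ⟶ Spec (.of K) :=
  Proj.toSpecZero (MvPolynomial.homogeneousSubmodule E K) ≫
    Spec.map (CommRingCat.ofHom (algebraMap K (MvPolynomial.homogeneousSubmodule E K 0)))

instance finiteType_zero [Fintype E] :
    Algebra.FiniteType (MvPolynomial.homogeneousSubmodule E K 0) (MvPolynomial E K) :=
  RingHom.FiniteType.of_comp_finiteType
    (f := algebraMap K (MvPolynomial.homogeneousSubmodule E K 0))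
    (g := algebraMap (MvPolynomial.homogeneousSubmodule E K 0) (MvPolynomial E K))
    ((RingHom.finiteType_algebraMap (A := K) (B := MvPolynomial E K)).2 inferInstance)

theorem algebraMap_zero_surjective :
    Function.Surjective (algebraMap K (MvPolynomial.homogeneousSubmodule E K 0)) := by
  rintro ⟨p, hp⟩
  rw [MvPolynomial.homogeneousSubmodule_zero, Submodule.mem_one] at hp
  obtain ⟨c, hc⟩ := hp
  exact ⟨c, Subtype.ext hc⟩

instance isClosedImmersion_zero : IsClosedImmersion
    (Spec.map (CommRingCat.ofHom (algebraMap K (MvPolynomial.homogeneousSubmodule E K 0)))) :=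
  IsClosedImmersion.spec_of_surjective _ (algebraMap_zero_surjective E K)

instance projSpaceHom_isProper [Fintype E] : IsProper (projSpaceHom E K) := by
  unfold projSpaceHom projSpace
  infer_instance

variable {E K}

/-- The evaluation of polynomials at a vector `v ∈ A^E`, as a map into the global sections
of `Spec A`. -/
def evalHom {A : Type} [CommRing A] [Algebra K A] (v : E → A) :
    MvPolynomial E K →+* Γ(Spec (.of A), ⊤) :=
  (Scheme.ΓSpecIso (.of A)).inv.hom.comp (MvPolynomial.aeval v : MvPolynomial E K →ₐ[K] A).toRingHom

theorem map_evalHom_irrelevant {A : Type} [CommRing A] [Algebra K A] (v : E → A)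
    (hv : ∃ i, IsUnit (v i)) :
    (HomogeneousIdeal.irrelevant (MvPolynomial.homogeneousSubmodule E K)).toIdeal.map
      (evalHom v) = ⊤ := by
  obtain ⟨i, hi⟩ := hv
  refine Ideal.eq_top_of_isUnit_mem _ (x := evalHom v (MvPolynomial.X i))
    (Ideal.mem_map_of_mem _ (HomogeneousIdeal.mem_irrelevant_of_mem _ one_pos
      (MvPolynomial.isHomogeneous_X K i))) ?_
  simpa [evalHom] using hi.map (Scheme.ΓSpecIso (.of A)).inv.hom

/-- The `A`-valued point `[v_i]_{i ∈ E}` of projective space, for a vector `v ∈ A^E` having a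
coordinate that is a unit. -/
def projPoint {A : Type} [CommRing A] [Algebra K A] (v : E → A) (hv : ∃ i, IsUnit (v i)) :
    Spec (.of A) ⟶ projSpace E K :=
  Proj.fromOfGlobalSections _ (evalHom v) (map_evalHom_irrelevant v hv)

theorem projPoint_projSpaceHom {A : Type} [CommRing A] [Algebra K A] (v : E → A)
    (hv : ∃ i, IsUnit (v i)) :
    projPoint v hv ≫ projSpaceHom E K = Spec.map (CommRingCat.ofHom (algebraMap K A)) := by
  rw [projPoint, projSpaceHom, ← Category.assoc, Proj.fromOfGlobalSections_toSpecZero,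
    Category.assoc, ← Spec.map_comp, ← CommRingCat.ofHom_comp]
  have h : ((evalHom v).comp (algebraMap (MvPolynomial.homogeneousSubmodule E K 0)
      (MvPolynomial E K))).comp (algebraMap K (MvPolynomial.homogeneousSubmodule E K 0)) =
      (Scheme.ΓSpecIso (.of A)).inv.hom.comp (algebraMap K A) := by
    ext c
    change (Scheme.ΓSpecIso (.of A)).inv.hom (MvPolynomial.aeval v (MvPolynomial.C c)) = _
    simp
  rw [h, CommRingCat.ofHom_comp, Spec.map_comp, ← Category.assoc]
  simp

/-- The ideal in the coordinate ring of `V × V*`, `V = K^E`, of the affine incidence variety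
`{(w, β) ∈ W × V* | β(w u) = 0 for all u ∈ W}`, where `w u` is the Hadamard product. The variables
`X (inl i)` and `X (inr i)` are the `i`-th coordinates of `w ∈ V` and `β ∈ V*`. The first set of
generators says that `w ∈ W`, the second one that `∑ i, β_i w_i u_i = 0` for all `u ∈ W`. -/
def incidenceIdeal [Fintype E] (W : Submodule K (E → K)) : Ideal (MvPolynomial (E ⊕ E) K) :=
  Ideal.span
    ({p | ∃ φ : E → K, (∀ w ∈ W, ∑ i, φ i * w i = 0) ∧
        p = ∑ i, MvPolynomial.C (φ i) * MvPolynomial.X (Sum.inl i)} ∪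
     {p | ∃ u ∈ W, p = ∑ i, MvPolynomial.C (u i) *
        (MvPolynomial.X (Sum.inl i) * MvPolynomial.X (Sum.inr i))})

/-- The coordinate ring of the affine incidence variety. -/
abbrev CoordRing [Fintype E] (W : Submodule K (E → K)) : Type :=
  MvPolynomial (E ⊕ E) K ⧸ incidenceIdeal W

/-- The function `w_i` on the affine incidence variety. -/
def wCoord [Fintype E] (W : Submodule K (E → K)) (i : E) : CoordRing W :=
  Ideal.Quotient.mk _ (MvPolynomial.X (Sum.inl i))

/-- The function `β_i` on the affine incidence variety. -/
def bCoord [Fintype E] (W : Submodule K (E → K)) (i : E) : CoordRing W :=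
  Ideal.Quotient.mk _ (MvPolynomial.X (Sum.inr i))

/-- The coordinate ring of the open part `w_j ≠ 0`, `β_k ≠ 0` of the affine incidence variety. -/
abbrev ChartRing [Fintype E] (W : Submodule K (E → K)) (jk : E × E) : Type :=
  Localization.Away (wCoord W jk.1 * bCoord W jk.2)

/-- The morphism `(w, β) ↦ ([w], [β])` to `ℙV × ℙV*` on the open part `w_j ≠ 0`, `β_k ≠ 0` of the
affine incidence variety. -/
def chartHom [Fintype E] (W : Submodule K (E → K)) (jk : E × E) :
    Spec (.of (ChartRing W jk)) ⟶ Limits.pullback (projSpaceHom E K) (projSpaceHom E K) :=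
  have h : IsUnit (algebraMap (CoordRing W) (ChartRing W jk) (wCoord W jk.1) *
      algebraMap (CoordRing W) (ChartRing W jk) (bCoord W jk.2)) := by
    rw [← map_mul]; exact IsLocalization.Away.algebraMap_isUnit _
  Limits.pullback.lift
    (projPoint (fun i => algebraMap (CoordRing W) (ChartRing W jk) (wCoord W i))
      ⟨jk.1, isUnit_of_mul_isUnit_left h⟩)
    (projPoint (fun i => algebraMap (CoordRing W) (ChartRing W jk) (bCoord W i))
      ⟨jk.2, isUnit_of_mul_isUnit_right h⟩)
    (by rw [projPoint_projSpaceHom, projPoint_projSpaceHom])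

/-- The morphism `(w, β) ↦ ([w], [β])` to `ℙV × ℙV*` on the disjoint union of the open parts
`w_j ≠ 0`, `β_k ≠ 0`, which together cover the locus `w ≠ 0`, `β ≠ 0` of the affine incidence
variety. -/
def biprojHom [Fintype E] (W : Submodule K (E → K)) :
    (∐ fun jk : E × E => Spec (.of (ChartRing W jk))) ⟶
      Limits.pullback (projSpaceHom E K) (projSpaceHom E K) :=
  Limits.Sigma.desc (chartHom W)

/-- Bloch's incidence variety `Λ_W ⊆ ℙV × ℙV*`: the biprojectivization, i.e. the scheme-theoretic
image under `(w, β) ↦ ([w], [β])`, of the locus `w ≠ 0`, `β ≠ 0` of the affine incidence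
variety. -/
def Lambda [Fintype E] (W : Submodule K (E → K)) : Scheme.{0} := (biprojHom W).image

/-- The structure morphism of `Λ_W`. -/
def lambdaHom [Fintype E] (W : Submodule K (E → K)) : Lambda W ⟶ Spec (.of K) :=
  (biprojHom W).imageι ≫ Limits.pullback.fst _ _ ≫ projSpaceHom E K

instance lambdaHom_isProper [Fintype E] (W : Submodule K (E → K)) : IsProper (lambdaHom W) := by
  unfold lambdaHom Lambda
  infer_instance

end scheme

end Configuration

end

/-!
# The class of Bloch's incidence variety

Only the underlying point set of `Λ_W` matters for its class: a scheme and its reduction have the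
same class, so every locally closed subset of a variety has one (`GrothendieckRing.setClass`), and
these classes are additive. The underlying set of `Λ_W` in `ℙV × ℙV*` is the closed set
`Configuration.incidenceSet` of pairs `([w], [β])` with `w ∈ W` and `β ⊥ w W`; its points are
studied through vectors over fields (`Configuration.exists_field_point`).

Stratify it by the set `F` of the coordinates of `w` that vanish. On a nonempty stratum `F` is a
proper flat of the matroid `M` (`Configuration.isFlat_of_mem_stratum`). The possible `[w]` form the
complement of the projective hyperplane arrangement of `M / F`. Normalizing a coordinate `w_j = 1`
and applying inclusion-exclusion to the affine spaces `{w ∈ W | w_A = 0, w_j = 1}`, `F ⊆ A`, one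
finds that its class is the reduced characteristic polynomial of `M / F` at `𝕃`
(`Configuration.exists_arrangement_complement`,
`Configuration.reducedCharPoly_contract_eq_sum`).

For a fixed such `w`, the products `w u`, `u ∈ W`, form a space of dimension `r = rk (M \ F)`, since
`w` is invertible outside `F`. Explicitly, for a basis `B` of `M \ F` the equations on `β` can be
solved for the coordinates in `B` (`Configuration.isIncident_iff_of_dual_vectors`), and the
remaining `|E| - r` coordinates are free. So the stratum is a bundle of projective spaces of
dimension `|E| - r - 1`. Decomposing it by the first nonzero free coordinate of `β`, normalized to
`1`, turns it into pieces that are products with affine spaces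
(`Configuration.setClass_stratum_first`), and the sum of their classes is
`1 + 𝕃 + ⋯ + 𝕃 ^ (|E| - r - 1)` times the class of the arrangement complement.
-/

open CategoryTheory AlgebraicGeometry
open scoped Polynomial

noncomputable section

/-! ### Classes of schemes and of locally closed subsets -/

namespace GrothendieckRing

variable {K : Type} [Field K]

open Classical in
/-- The class in the Grothendieck ring of the `K`-scheme with structure morphism `f`; it is `0` by
convention if the scheme is not a variety. -/
def schemeClass {X : Scheme.{0}} (f : X ⟶ Spec (.of K)) : K₀Var K :=
  if h : isVariety K (Over.mk f) then
    Ideal.Quotient.mk (scissorIdeal K) (IsoClassRing.of ⟨Over.mk f, h⟩)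
  else 0

theorem schemeClass_of_isVariety {X : Scheme.{0}} {f : X ⟶ Spec (.of K)}
    (h : isVariety K (Over.mk f)) :
    schemeClass f = Ideal.Quotient.mk (scissorIdeal K) (IsoClassRing.of ⟨Over.mk f, h⟩) :=
  dif_pos h

theorem cls_eq_schemeClass {X : Scheme.{0}} (f : X ⟶ Spec (.of K))
    [h₁ : LocallyOfFiniteType f] [h₂ : QuasiCompact f] [h₃ : IsSeparated f] :
    cls f = schemeClass f :=
  (schemeClass_of_isVariety (f := f) ⟨h₁, h₂, h₃⟩).symm

theorem IsoClassRing.of_eq_of_iso {X Y : Var K} (e : X ≅ Y) :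
    IsoClassRing.of X = IsoClassRing.of Y := by
  rw [IsoClassRing.of, IsoClassRing.of, toSkeleton_eq_toSkeleton_iff.2 ⟨e⟩]

theorem isVariety_of_iso {X Y : Scheme.{0}} {f : X ⟶ Spec (.of K)} {g : Y ⟶ Spec (.of K)}
    (hf : isVariety K (Over.mk f)) (e : X ≅ Y) (h : e.hom ≫ g = f) : isVariety K (Over.mk g) := by
  obtain ⟨h₁, h₂, h₃⟩ := hf
  obtain rfl : e.inv ≫ f = g := by rw [← h, Iso.inv_hom_id_assoc]
  dsimp at h₁ h₂ h₃
  exact ⟨inferInstanceAs (LocallyOfFiniteType (e.inv ≫ f)),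
    inferInstanceAs (QuasiCompact (e.inv ≫ f)), inferInstanceAs (IsSeparated (e.inv ≫ f))⟩

theorem schemeClass_eq_of_iso {X Y : Scheme.{0}} {f : X ⟶ Spec (.of K)} {g : Y ⟶ Spec (.of K)}
    (e : X ≅ Y) (h : e.hom ≫ g = f) : schemeClass f = schemeClass g := by
  by_cases hf : isVariety K (Over.mk f)
  · have hg := isVariety_of_iso hf e h
    rw [schemeClass_of_isVariety hf, schemeClass_of_isVariety hg]
    congr 1
    exact IsoClassRing.of_eq_of_iso ((isVariety K).isoMk (Over.isoMk e h))
  · have hg : ¬ isVariety K (Over.mk g) := fun hg =>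
      hf (isVariety_of_iso hg e.symm (by rw [← h]; simp))
    rw [schemeClass, schemeClass, dif_neg hf, dif_neg hg]

theorem isNoetherian_of_isVariety {X : Scheme.{0}} {f : X ⟶ Spec (.of K)}
    (hf : isVariety K (Over.mk f)) : IsNoetherian X := by
  obtain ⟨h₁, h₂, h₃⟩ := hf
  dsimp at h₁ h₂ h₃
  have := LocallyOfFiniteType.isLocallyNoetherian f
  have : CompactSpace X := QuasiCompact.compactSpace_of_compactSpace f
  exact {}

theorem isVariety_comp {X Z : Scheme.{0}} {f : X ⟶ Spec (.of K)}
    (hf : isVariety K (Over.mk f)) (i : Z ⟶ X) [IsImmersion i] :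
    isVariety K (Over.mk (i ≫ f)) := by
  have := isNoetherian_of_isVariety hf
  obtain ⟨h₁, h₂, h₃⟩ := hf
  dsimp at h₁ h₂ h₃
  have : QuasiCompact i := by
    have : TopologicalSpace.NoetherianSpace Z :=
      i.isEmbedding.isInducing.noetherianSpace
    infer_instance
  exact ⟨inferInstanceAs (LocallyOfFiniteType (i ≫ f)),
    inferInstanceAs (QuasiCompact (i ≫ f)), inferInstanceAs (IsSeparated (i ≫ f))⟩

theorem schemeClass_scissor {X Z U : Scheme.{0}} {f : X ⟶ Spec (.of K)}
    (hf : isVariety K (Over.mk f)) (i : Z ⟶ X) (j : U ⟶ X) [hi : IsClosedImmersion i]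
    [hj : IsOpenImmersion j] (h : Set.range j = (Set.range i)ᶜ) :
    schemeClass f = schemeClass (i ≫ f) + schemeClass (j ≫ f) := by
  rw [schemeClass_of_isVariety hf, schemeClass_of_isVariety (isVariety_comp hf i),
    schemeClass_of_isVariety (isVariety_comp hf j), ← map_add, Ideal.Quotient.eq]
  let X' : Var K := ⟨Over.mk f, hf⟩
  let Z' : Var K := ⟨Over.mk (i ≫ f), isVariety_comp hf i⟩
  let U' : Var K := ⟨Over.mk (j ≫ f), isVariety_comp hf j⟩
  let i' : Z' ⟶ X' := ObjectProperty.homMk (Over.homMk i)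
  let j' : U' ⟶ X' := ObjectProperty.homMk (Over.homMk j)
  exact Ideal.subset_span ⟨X', Z', U', i', j', hi, hj, h, rfl⟩

/-- The empty scheme has class `0`, as it is the disjoint union of two copies of itself. -/
theorem schemeClass_of_isEmpty {X : Scheme.{0}} [IsEmpty X] (f : X ⟶ Spec (.of K)) :
    schemeClass f = 0 := by
  by_cases hf : isVariety K (Over.mk f)
  · have := schemeClass_scissor hf (𝟙 X) (𝟙 X) (Subsingleton.elim _ _)
    rw [Category.id_comp] at this
    simpa using this
  · exact dif_neg hf

/-- The class does not see nilpotents: it is unchanged under a surjective closed immersion. -/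
theorem schemeClass_eq_of_surjective {X Z : Scheme.{0}} {f : X ⟶ Spec (.of K)}
    (hf : isVariety K (Over.mk f)) (i : Z ⟶ X) [IsClosedImmersion i]
    (h : Set.range i = Set.univ) : schemeClass (i ≫ f) = schemeClass f := by
  have h0 := schemeClass_scissor hf i (Scheme.Opens.ι (⊥ : X.Opens)) (by simp [h])
  have : IsEmpty (⊥ : X.Opens).toScheme := inferInstanceAs (IsEmpty (∅ : Set X))
  rw [h0, schemeClass_of_isEmpty (_ ≫ f : (⊥ : X.Opens).toScheme ⟶ _), add_zero]

/-- Two immersions into a variety with the same set-theoretic image have sources of the same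
class: both agree with the class of the fibre product. -/
theorem schemeClass_eq_of_range_eq {X Z Z' : Scheme.{0}} {f : X ⟶ Spec (.of K)}
    (hf : isVariety K (Over.mk f)) (i : Z ⟶ X) (i' : Z' ⟶ X) [IsImmersion i] [IsImmersion i']
    (h : Set.range i = Set.range i') : schemeClass (i ≫ f) = schemeClass (i' ≫ f) := by
  have h1 : Set.range (Limits.pullback.fst i i') = Set.univ := by
    rw [Scheme.Pullback.range_fst, ← h]
    ext; simp
  have h2 : Set.range (Limits.pullback.snd i i') = Set.univ := by
    rw [Scheme.Pullback.range_snd, h]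
    ext; simp
  have : IsClosedImmersion (Limits.pullback.fst i i') :=
    .of_isPreimmersion _ (by rw [h1]; exact isClosed_univ)
  have : IsClosedImmersion (Limits.pullback.snd i i') :=
    .of_isPreimmersion _ (by rw [h2]; exact isClosed_univ)
  rw [← schemeClass_eq_of_surjective (isVariety_comp hf i) _ h1,
    ← schemeClass_eq_of_surjective (isVariety_comp hf i') _ h2,
    Limits.pullback.condition_assoc]

/-- The class of a locally closed subset `S` of the `K`-scheme with structure morphism `f`: the
class of any subscheme with underlying set `S`. It is `0` by convention if there is none. -/
def setClass {X : Scheme.{0}} (f : X ⟶ Spec (.of K)) (S : Set X) : K₀Var K :=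
  open Classical in
  if h : ∃ (Z : Scheme.{0}) (i : Z ⟶ X), IsImmersion i ∧ Set.range i = S then
    schemeClass (h.choose_spec.choose ≫ f)
  else 0

theorem setClass_range {X Z : Scheme.{0}} {f : X ⟶ Spec (.of K)}
    (hf : isVariety K (Over.mk f)) (i : Z ⟶ X) [hi : IsImmersion i] :
    setClass f (Set.range i) = schemeClass (i ≫ f) := by
  have h : ∃ (Z' : Scheme.{0}) (i' : Z' ⟶ X), IsImmersion i' ∧ Set.range i' = Set.range i :=
    ⟨Z, i, hi, rfl⟩
  rw [setClass, dif_pos h]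
  have := h.choose_spec.choose_spec.1
  exact schemeClass_eq_of_range_eq hf _ _ h.choose_spec.choose_spec.2

theorem setClass_empty {X : Scheme.{0}} {f : X ⟶ Spec (.of K)}
    (hf : isVariety K (Over.mk f)) : setClass f ∅ = 0 := by
  have : IsEmpty (⊥ : X.Opens).toScheme := inferInstanceAs (IsEmpty (∅ : Set X))
  have h := setClass_range hf (Scheme.Opens.ι (⊥ : X.Opens))
  rw [schemeClass_of_isEmpty] at h
  simpa using h

theorem exists_isImmersion_range_eq {X : Scheme.{0}} {S : Set X} (hS : IsLocallyClosed S) :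
    ∃ (Z : Scheme.{0}) (i : Z ⟶ X), IsImmersion i ∧ Set.range i = S := by
  obtain ⟨U, C, hU, hC, rfl⟩ := hS
  let U' : X.Opens := ⟨U, hU⟩
  let C' : TopologicalSpace.Closeds X := ⟨C, hC⟩
  let I := Scheme.IdealSheafData.vanishingIdeal C'
  refine ⟨_, Limits.pullback.fst U'.ι I.subschemeι ≫ U'.ι, inferInstance, ?_⟩
  rw [Scheme.Hom.comp_base, TopCat.coe_comp, Set.range_comp, Scheme.Pullback.range_fst,
    Set.image_preimage_eq_inter_range]
  simp [I, C', U', Set.inter_comm]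

/-- Additivity of the class of locally closed subsets. -/
theorem setClass_inter_add_diff {X : Scheme.{0}} {f : X ⟶ Spec (.of K)}
    (hf : isVariety K (Over.mk f)) {S : Set X} (hS : IsLocallyClosed S) (D : X.Opens) :
    setClass f S = setClass f (S ∩ D) + setClass f (S ∩ (D : Set X)ᶜ) := by
  obtain ⟨Z, i, hi, rfl⟩ := exists_isImmersion_range_eq hS
  let C : TopologicalSpace.Closeds X := ⟨(D : Set X)ᶜ, D.2.isClosed_compl⟩
  let I := Scheme.IdealSheafData.vanishingIdeal C
  let a := Limits.pullback.fst i I.subschemeι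
  let b := (i ⁻¹ᵁ D).ι
  have ha : Set.range a = i ⁻¹' (D : Set X)ᶜ := by
    rw [Scheme.Pullback.range_fst]; simp [I, C]
  have hb : Set.range b = i ⁻¹' (D : Set X) := by simp [b]
  have h1 : Set.range (a ≫ i) = Set.range i ∩ (D : Set X)ᶜ := by
    rw [Scheme.Hom.comp_base, TopCat.coe_comp, Set.range_comp, ha,
      Set.image_preimage_eq_inter_range, Set.inter_comm]
  have h2 : Set.range (b ≫ i) = Set.range i ∩ (D : Set X) := by
    rw [Scheme.Hom.comp_base, TopCat.coe_comp, Set.range_comp, hb,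
      Set.image_preimage_eq_inter_range, Set.inter_comm]
  rw [← h1, ← h2, setClass_range hf, setClass_range hf, setClass_range hf,
    schemeClass_scissor (isVariety_comp hf i) a b (by rw [ha, hb]; simp), add_comm,
    Category.assoc, Category.assoc]

end GrothendieckRing

/-! ### Stratifications and affine schemes -/

namespace GrothendieckRing

variable {K : Type} [Field K]

section stratification

variable {X : Scheme.{0}} {f : X ⟶ Spec (.of K)} (hf : isVariety K (Over.mk f)) {ι : Type*}
  (D : ι → X.Opens)

theorem isLocallyClosed_inter_forall_notMem {S : Set X} (hS : IsLocallyClosed S)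
    (A : Finset ι) :
    IsLocallyClosed {x ∈ S | ∀ i ∈ A, x ∉ D i} := by
  have h : {x ∈ S | ∀ i ∈ A, x ∉ D i} = S ∩ ⋂ i ∈ A, (D i : Set X)ᶜ := by ext; simp
  rw [h]
  exact hS.inter (isClosed_biInter fun i _ => (D i).isOpen.isClosed_compl).isLocallyClosed

include hf

/-- A locally closed set is stratified according to which of the open sets `D i`, `i ∈ s`, contain
a given point. -/
theorem setClass_eq_sum_powerset [DecidableEq ι] (s : Finset ι) {S : Set X}
    (hS : IsLocallyClosed S) :
    setClass f S = ∑ F ∈ s.powerset, setClass f {x ∈ S | ∀ i ∈ s, x ∈ D i ↔ i ∉ F} := by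
  induction s using Finset.induction_on generalizing S with
  | empty => simp
  | insert a s ha ih =>
    rw [setClass_inter_add_diff hf hS (D a), ih (hS.inter (D a).isOpen.isLocallyClosed),
      ih (hS.inter (D a).isOpen.isClosed_compl.isLocallyClosed), Finset.sum_powerset_insert ha]
    congr 1 <;> refine Finset.sum_congr rfl fun F hF => congrArg _ (Set.ext fun x => ?_)
    · have haF : a ∉ F := fun h => ha (Finset.mem_powerset.1 hF h)
      simp [haF, and_assoc]
    · have h : ∀ i ∈ s, i ≠ a := fun i hi h => ha (h ▸ hi)
      simp only [Set.mem_inter_iff, Set.mem_compl_iff, SetLike.mem_coe, Set.mem_ofPred_eq,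
        Finset.mem_insert, forall_eq_or_imp, and_assoc, not_or, not_true]
      refine and_congr_right fun _ => and_congr (by simp) (forall₂_congr fun i hi => ?_)
      simp [h i hi]

/-- Inclusion-exclusion for the intersection of a locally closed set with the open sets `D i`. -/
theorem setClass_forall_mem_eq_sum [DecidableEq ι] (s : Finset ι) {S : Set X}
    (hS : IsLocallyClosed S) :
    setClass f {x ∈ S | ∀ i ∈ s, x ∈ D i} =
      ∑ A ∈ s.powerset, (-1) ^ A.card * setClass f {x ∈ S | ∀ i ∈ A, x ∉ D i} := by
  induction s using Finset.induction_on generalizing S with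
  | empty => simp
  | insert a s ha ih =>
    have h1 : {x ∈ S | ∀ i ∈ insert a s, x ∈ D i} = {x ∈ S ∩ D a | ∀ i ∈ s, x ∈ D i} := by
      ext x; simp [and_assoc]
    rw [h1, ih (hS.inter (D a).isOpen.isLocallyClosed), Finset.sum_powerset_insert ha,
      ← Finset.sum_add_distrib]
    refine Finset.sum_congr rfl fun A hA => ?_
    have haA : a ∉ A := fun h => ha (Finset.mem_powerset.1 hA h)
    rw [setClass_inter_add_diff hf (isLocallyClosed_inter_forall_notMem D hS A) (D a),
      Finset.card_insert_of_notMem haA]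
    have h2 : {x ∈ S | ∀ i ∈ A, x ∉ D i} ∩ D a = {x ∈ S ∩ D a | ∀ i ∈ A, x ∉ D i} := by
      ext x; simp only [Set.mem_inter_iff, Set.mem_ofPred_eq]; tauto
    have h3 : {x ∈ S | ∀ i ∈ A, x ∉ D i} ∩ (D a : Set X)ᶜ =
        {x ∈ S | ∀ i ∈ insert a A, x ∉ D i} := by
      ext x
      simp only [Set.mem_inter_iff, Set.mem_ofPred_eq, Finset.mem_insert, forall_eq_or_imp,
        Set.mem_compl_iff, SetLike.mem_coe]
      tauto
    rw [h2, h3]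
    ring

/-- A locally closed set is stratified according to the first of the open sets `D 0, D 1, …` that
contains a given point. -/
theorem setClass_eq_sum_first {m : ℕ} (D : Fin m → X.Opens) {S : Set X}
    (hS : IsLocallyClosed S) :
    setClass f S = ∑ t, setClass f {x ∈ S | x ∈ D t ∧ ∀ s < t, x ∉ D s} +
      setClass f {x ∈ S | ∀ s, x ∉ D s} := by
  induction m generalizing S with
  | zero => simp
  | succ m ih =>
    rw [setClass_inter_add_diff hf hS (D 0),
      ih (fun i => D i.succ) (hS.inter (D 0).isOpen.isClosed_compl.isLocallyClosed),
      Fin.sum_univ_succ, add_assoc]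
    congr 1
    · congr 1; ext x; simp
    congr 1
    · refine Finset.sum_congr rfl fun t _ => congrArg _ (Set.ext fun x => ?_)
      simp only [Set.mem_inter_iff, Set.mem_compl_iff, SetLike.mem_coe, Set.mem_ofPred_eq,
        Fin.forall_fin_succ, Fin.succ_pos, Fin.succ_lt_succ_iff, forall_const]
      tauto
    · congr 1; ext x
      simp only [Set.mem_inter_iff, Set.mem_compl_iff, SetLike.mem_coe, Set.mem_ofPred_eq,
        Fin.forall_fin_succ]
      tauto

end stratification

section affine

variable (K)

/-- The class of the spectrum of a `K`-algebra. -/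
def affineClass (R : Type) [CommRing R] [Algebra K R] : K₀Var K :=
  schemeClass (Spec.map (CommRingCat.ofHom (algebraMap K R)))

variable (R : Type) [CommRing R] [Algebra K R]

theorem isVariety_Spec [Algebra.FiniteType K R] :
    isVariety K (Over.mk (Spec.map (CommRingCat.ofHom (algebraMap K R)))) := by
  refine ⟨?_, inferInstanceAs (QuasiCompact (Spec.map _)),
    inferInstanceAs (IsSeparated (Spec.map _))⟩
  exact (HasRingHomProperty.Spec_iff (P := @LocallyOfFiniteType)).2
    (RingHom.finiteType_algebraMap.2 inferInstance)

variable {K R} in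
theorem affineClass_congr {R' : Type} [CommRing R'] [Algebra K R']
    (e : R ≃ₐ[K] R') : affineClass K R = affineClass K R' := by
  refine schemeClass_eq_of_iso
    (Scheme.Spec.mapIso e.toRingEquiv.toCommRingCatIso.symm.op) ?_
  refine (Spec.map_comp _ _).symm.trans ?_
  congr 1
  ext c
  exact e.symm.commutes c

theorem affineClass_self : affineClass K K = 1 := by
  rw [affineClass, schemeClass_of_isVariety (isVariety_Spec K K), ← map_one (Ideal.Quotient.mk _)]
  congr 1
  rw [IsoClassRing.of, ← map_one (MonoidAlgebra.of ℤ (Skeleton (Var K))), Skeleton.one_eq]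
  congr 1
  refine toSkeleton_eq_toSkeleton_iff.2 ⟨(isVariety K).isoMk (Over.isoMk (Iso.refl _) ?_)⟩
  dsimp
  rw [Category.id_comp]
  exact (Spec.map_id _).symm

variable {K}

theorem schemeClass_mul {X Y : Scheme.{0}} {f : X ⟶ Spec (.of K)} {g : Y ⟶ Spec (.of K)}
    (hf : isVariety K (Over.mk f)) (hg : isVariety K (Over.mk g)) :
    schemeClass f * schemeClass g = schemeClass (Limits.pullback.fst f g ≫ f) := by
  let X' : Var K := ⟨Over.mk f, hf⟩
  let Y' : Var K := ⟨Over.mk g, hg⟩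
  have h : isVariety K (Over.mk (Limits.pullback.fst f g ≫ f)) :=
    (MonoidalCategory.tensorObj X' Y').property
  rw [schemeClass_of_isVariety hf, schemeClass_of_isVariety hg, schemeClass_of_isVariety h,
    ← map_mul]
  congr 1
  rw [IsoClassRing.of, IsoClassRing.of, IsoClassRing.of, ← map_mul,
    ← Skeleton.toSkeleton_tensorObj]
  rfl

variable (K)

theorem affineClass_mvPolynomial_pUnit [Algebra.FiniteType K R] :
    affineClass K (MvPolynomial PUnit R) = affineClass K R * lefschetz K := by
  have hL : isVariety K (Over.mk (𝔸(PUnit; Spec (.of K)) ↘ Spec (.of K))) :=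
    ⟨inferInstanceAs (LocallyOfFiniteType (𝔸(PUnit; Spec (.of K)) ↘ _)),
      inferInstanceAs (QuasiCompact (𝔸(PUnit; Spec (.of K)) ↘ _)),
      inferInstanceAs (IsSeparated (𝔸(PUnit; Spec (.of K)) ↘ _))⟩
  rw [lefschetz, cls_eq_schemeClass, affineClass, affineClass,
    schemeClass_mul (isVariety_Spec K R) hL]
  let φ := Spec.map (CommRingCat.ofHom (algebraMap K R))
  have hpb := (AffineSpace.isPullback_map (n := PUnit) φ).flip
  refine schemeClass_eq_of_iso
    ((AffineSpace.SpecIso PUnit (.of R)).symm ≪≫ hpb.isoPullback) ?_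
  rw [Iso.trans_hom, Category.assoc, IsPullback.isoPullback_hom_fst_assoc, Iso.symm_hom]
  rw [AffineSpace.SpecIso_inv_over_assoc, ← Spec.map_comp, ← CommRingCat.ofHom_comp]
  rfl

theorem affineClass_mvPolynomial (σ : Type) [Fintype σ] [Algebra.FiniteType K R] :
    affineClass K (MvPolynomial σ R) = affineClass K R * lefschetz K ^ Fintype.card σ := by
  suffices h : affineClass K (MvPolynomial σ R) = affineClass K R * lefschetz K ^ Nat.card σ by
    rw [h, Nat.card_eq_fintype_card]
  refine Finite.induction_empty_option (P := fun σ => affineClass K (MvPolynomial σ R) =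
    affineClass K R * lefschetz K ^ Nat.card σ) (fun {σ τ} e ih => ?_) ?_ (fun {σ} _ ih => ?_) σ
  · rw [← Nat.card_congr e, ← ih]
    exact (affineClass_congr ((MvPolynomial.renameEquiv R e).restrictScalars K)).symm
  · rw [affineClass_congr ((MvPolynomial.isEmptyAlgEquiv R PEmpty).restrictScalars K)]
    simp
  · rw [affineClass_congr ((MvPolynomial.optionEquivLeft R σ).restrictScalars K),
      ← affineClass_congr
        ((MvPolynomial.uniqueAlgEquiv (MvPolynomial σ R) PUnit).restrictScalars K),
      affineClass_mvPolynomial_pUnit, ih, Finite.card_option, pow_succ, mul_assoc]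

end affine

end GrothendieckRing

/-! ### Points of projective space -/

/-- On the spectrum of `R`, the morphism to `Proj` given by `f : B → Γ(Spec R)` factors through
`D₊(t)` as soon as the image of `t` is a unit, which is expressed here by an extension `φ` of `f`
to the localization at `t`. -/
theorem fromOfGlobalSections_eq_SpecMap_awayι {σ B : Type} [CommRing B] [SetLike σ B]
    [AddSubgroupClass σ B] (𝒜 : ℕ → σ) [GradedRing 𝒜] {R : CommRingCat.{0}}
    (f : B →+* Γ(Spec R, ⊤))
    (hf : (HomogeneousIdeal.irrelevant 𝒜).toIdeal.map f = ⊤) {t : B} {d : ℕ} (ht : t ∈ 𝒜 d)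
    (hd : 0 < d) (φ : Localization.Away t →+* R)
    (hφ : φ.comp (algebraMap B _) = (Scheme.ΓSpecIso R).hom.hom.comp f) :
    Proj.fromOfGlobalSections 𝒜 f hf =
      Spec.map (CommRingCat.ofHom (φ.comp
        (algebraMap (HomogeneousLocalization.Away 𝒜 t) (Localization.Away t)))) ≫
      Proj.awayι 𝒜 t ht hd := by
  have hφt : (Scheme.ΓSpecIso R).hom.hom (f t) = φ (algebraMap B _ t) :=
    (RingHom.congr_fun hφ t).symm
  have hθ : IsUnit ((Scheme.ΓSpecIso R).hom.hom (f t)) := by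
    rw [hφt]
    exact (IsLocalization.Away.algebraMap_isUnit t).map φ
  have hux : IsUnit (f t) := by
    have := hθ.map (Scheme.ΓSpecIso R).inv.hom
    simpa using this
  have htop : (Spec R).basicOpen (f t) = ⊤ := Scheme.basicOpen_of_isUnit _ hux
  have hiso : IsIso ((Spec R).basicOpen (f t)).ι := by
    rw [htop, ← Scheme.topIso_hom]; infer_instance
  rw [← cancel_epi ((Spec R).basicOpen (f t)).ι]
  have h1 : ((Spec R).basicOpen (f t)).ι ≫ Proj.fromOfGlobalSections 𝒜 f hf =
      Proj.toBasicOpenOfGlobalSections 𝒜 f rfl hd ht ≫ Scheme.Opens.ι _ :=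
    (Proj.openCoverOfMapIrrelevantEqTop _ f hf).ι_glueMorphisms _ _ ⟨d, t, hd, ht⟩
  rw [h1]
  let θ : Localization.Away (f t) →+* R :=
    IsLocalization.Away.lift (f t) (g := (Scheme.ΓSpecIso R).hom.hom) hθ
  have h2 : ((Spec R).basicOpen (f t)).ι ≫ Spec.map (CommRingCat.ofHom θ) =
      ((Spec R).isoOfEq ((Spec R).toSpecΓ_preimage_basicOpen (f t))).inv ≫
        (Spec R).toSpecΓ ∣_ _ ≫ (basicOpenIsoSpecAway (f t)).hom := by
    rw [← cancel_mono
      (Spec.map (CommRingCat.ofHom (algebraMap Γ(Spec R, ⊤) (Localization.Away (f t)))))]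
    rw [Category.assoc, ← Spec.map_comp, ← CommRingCat.ofHom_comp, IsLocalization.Away.lift_comp,
      CommRingCat.ofHom_hom, SpecMap_ΓSpecIso_hom]
    simp only [Category.assoc]
    rw [basicOpenIsoSpecAway_hom_SpecMap]
    have h3 := morphismRestrict_ι (Spec R).toSpecΓ (PrimeSpectrum.basicOpen (f t))
    refine Eq.trans ?_ (congrArg (fun g => ((Spec R).isoOfEq
      ((Spec R).toSpecΓ_preimage_basicOpen (f t))).inv ≫ g) h3.symm)
    exact (Scheme.isoOfEq_inv_ι_assoc _ _ _).symm
  rw [Proj.toBasicOpenOfGlobalSections]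
  simp only [Category.assoc, Proj.basicOpenIsoSpec_inv_ι]
  rw [← reassoc_of% h2]
  simp only [← Category.assoc]
  congr 1
  simp only [Category.assoc]
  congr 1
  rw [← Spec.map_comp, ← CommRingCat.ofHom_comp]
  congr 2
  rw [← RingHom.comp_assoc]
  congr 1
  apply IsLocalization.ringHom_ext (Submonoid.powers t)
  rw [RingHom.comp_assoc, IsLocalization.map_comp,
    ← RingHom.comp_assoc, IsLocalization.Away.lift_comp, hφ]

namespace Configuration

attribute [local instance] MvPolynomial.gradedAlgebra

variable {E K : Type} [Field K] {A : Type} [CommRing A] [Algebra K A]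

theorem X_mem_homogeneousSubmodule (j : E) :
    MvPolynomial.X j ∈ MvPolynomial.homogeneousSubmodule E K 1 :=
  MvPolynomial.isHomogeneous_X K j

/-- The ring homomorphism `p / X_j ^ n ↦ p(v) / v_j ^ n` for a vector `v` with `v_j` a unit. -/
def awayEval (v : E → A) (j : E) (hj : IsUnit (v j)) :
    HomogeneousLocalization.Away (MvPolynomial.homogeneousSubmodule E K) (MvPolynomial.X j) →+* A :=
  (IsLocalization.Away.lift (S := Localization.Away (MvPolynomial.X j : MvPolynomial E K))
    (MvPolynomial.X j : MvPolynomial E K)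
    (g := (MvPolynomial.aeval v : MvPolynomial E K →ₐ[K] A).toRingHom) (by simpa using hj)).comp
  (algebraMap _ _)

/-- The point `[v]` factors through the chart `X_j ≠ 0` as soon as `v_j` is a unit. -/
theorem projPoint_eq (v : E → A) (j : E) (hj : IsUnit (v j)) :
    projPoint (K := K) v ⟨j, hj⟩ = Spec.map (CommRingCat.ofHom (awayEval v j hj)) ≫
      Proj.awayι (MvPolynomial.homogeneousSubmodule E K) (MvPolynomial.X j)
        (X_mem_homogeneousSubmodule j) one_pos := by
  refine fromOfGlobalSections_eq_SpecMap_awayι (R := .of A) _ _ _ _ _ _ ?_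
  rw [IsLocalization.Away.lift_comp]
  refine RingHom.ext fun p => ?_
  change _ = (Scheme.ΓSpecIso (.of A)).hom.hom ((Scheme.ΓSpecIso (.of A)).inv.hom _)
  exact (ConcreteCategory.congr_hom (Scheme.ΓSpecIso (.of A)).inv_hom_id
    (MvPolynomial.aeval v p : A)).symm

theorem awayEval_eq_iff (v : E → A) (j : E) (hj : IsUnit (v j)) {n : ℕ} {p : MvPolynomial E K}
    (hp) (a : A) :
    awayEval v j hj (HomogeneousLocalization.Away.mk (MvPolynomial.homogeneousSubmodule E K)
      (X_mem_homogeneousSubmodule j) n p hp) = a ↔ MvPolynomial.aeval v p = v j ^ n * a := by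
  rw [← (hj.pow n).mul_right_inj]
  have h : v j ^ n * awayEval v j hj (HomogeneousLocalization.Away.mk
      (MvPolynomial.homogeneousSubmodule E K) (X_mem_homogeneousSubmodule j) n p hp) =
      MvPolynomial.aeval v p := by
    rw [awayEval, RingHom.comp_apply, HomogeneousLocalization.algebraMap_apply,
      HomogeneousLocalization.Away.val_mk, Localization.mk_eq_mk']
    set L := IsLocalization.Away.lift (S := Localization.Away (MvPolynomial.X j : MvPolynomial E K))
      (MvPolynomial.X j : MvPolynomial E K)
      (g := (MvPolynomial.aeval v : MvPolynomial E K →ₐ[K] A).toRingHom) (by simpa using hj) with hL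
    have h2 : ∀ q, L (algebraMap _ _ q) = MvPolynomial.aeval v q := fun q =>
      IsLocalization.Away.lift_eq _ _ _
    rw [show v j ^ n = L (algebraMap _ _ (MvPolynomial.X j ^ n : MvPolynomial E K)) by
      rw [h2, map_pow, MvPolynomial.aeval_X], ← map_mul, ← h2]
    congr 1
    exact IsLocalization.mk'_spec' _ p
      (⟨MvPolynomial.X j ^ n, ⟨n, rfl⟩⟩ : Submonoid.powers (MvPolynomial.X j : MvPolynomial E K))
  rw [h]

theorem aeval_smul_of_isHomogeneous {n : ℕ} {p : MvPolynomial E K} (hp : p.IsHomogeneous n)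
    (c : A) (v : E → A) :
    MvPolynomial.aeval (fun i => c * v i) p = c ^ n * MvPolynomial.aeval v p := by
  rw [MvPolynomial.aeval_def, MvPolynomial.aeval_def, MvPolynomial.eval₂_eq, MvPolynomial.eval₂_eq,
    Finset.mul_sum]
  refine Finset.sum_congr rfl fun d hd => ?_
  have hdeg : ∑ i ∈ d.support, d i = n := by
    have := hp (MvPolynomial.mem_support_iff.1 hd)
    simpa [Finsupp.weight_apply, Finsupp.sum] using this
  simp only [mul_pow, Finset.prod_mul_distrib, Finset.prod_pow_eq_pow_sum, hdeg]
  ring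

theorem projPoint_smul (v : E → A) (c : A) (hc : IsUnit c) (hv : ∃ i, IsUnit (v i))
    (hcv : ∃ i, IsUnit (c * v i)) :
    projPoint (K := K) (fun i => c * v i) hcv = projPoint v hv := by
  obtain ⟨j, hj⟩ := hv
  rw [projPoint_eq v j hj, projPoint_eq (fun i => c * v i) j (hc.mul hj)]
  congr 3
  refine RingHom.ext fun z => ?_
  obtain ⟨n, p, hp, rfl⟩ := HomogeneousLocalization.Away.mk_surjective _
    (X_mem_homogeneousSubmodule j) z
  rw [awayEval_eq_iff, aeval_smul_of_isHomogeneous hp, mul_pow, mul_assoc, smul_eq_mul, mul_one,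
    (awayEval_eq_iff v j hj hp _).1 rfl]

theorem SpecMap_projPoint {B : Type} [CommRing B] [Algebra K B] (φ : A →ₐ[K] B) (v : E → A)
    (hv : ∃ i, IsUnit (v i)) (hv' : ∃ i, IsUnit (φ (v i))) :
    Spec.map (CommRingCat.ofHom φ.toRingHom) ≫ projPoint (K := K) v hv =
      projPoint (fun i => φ (v i)) hv' := by
  obtain ⟨j, hj⟩ := hv
  rw [projPoint_eq v j hj, projPoint_eq (fun i => φ (v i)) j (hj.map φ), ← Category.assoc,
    ← Spec.map_comp, ← CommRingCat.ofHom_comp]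
  congr 3
  refine RingHom.ext fun z => ?_
  obtain ⟨n, p, hp, rfl⟩ := HomogeneousLocalization.Away.mk_surjective _
    (X_mem_homogeneousSubmodule j) z
  symm
  rw [awayEval_eq_iff]
  have h := congrArg φ ((awayEval_eq_iff v j hj hp _).1 rfl)
  rw [map_mul, map_pow] at h
  rw [← AlgHom.comp_apply, MvPolynomial.comp_aeval] at h
  exact h

theorem projPoint_preimage (v : E → A) (hv : ∃ i, IsUnit (v i)) (i : E) :
    projPoint (K := K) v hv ⁻¹ᵁ Proj.basicOpen _ (MvPolynomial.X i) =
      PrimeSpectrum.basicOpen (v i) := by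
  rw [projPoint, Proj.fromOfGlobalSections_preimage_basicOpen _ _ _ one_pos
    (X_mem_homogeneousSubmodule i)]
  have h : evalHom (K := K) v (MvPolynomial.X i) = (Scheme.ΓSpecIso (.of A)).inv.hom (v i) := by
    simp [evalHom]
  rw [h, basicOpen_eq_of_affine']
  congr 1
  exact ConcreteCategory.congr_hom (Scheme.ΓSpecIso (.of A)).inv_hom_id (v i)

end Configuration

/-! ### Points of a product of projective spaces -/

/-- If `φ : A → B` becomes surjective after inverting `f`, which is already a unit in `B`, then `φ`
identifies `Spec B` with a closed subscheme of the basic open set of `f`. -/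
theorem isImmersion_SpecMap_of_forall_exists {A B : Type} [CommRing A] [CommRing B] (φ : A →+* B)
    (f : A) (hf : IsUnit (φ f)) (h : ∀ b, ∃ a n, φ a = φ f ^ n * b) :
    IsImmersion (Spec.map (CommRingCat.ofHom φ)) := by
  let ψ : Localization.Away f →+* B := IsLocalization.Away.lift f hf
  have hψ : ψ.comp (algebraMap A _) = φ := IsLocalization.Away.lift_comp _ _
  have hψ' : ∀ a, ψ (algebraMap A _ a) = φ a := fun a => IsLocalization.Away.lift_eq _ _ _
  have hs : Function.Surjective ψ := by
    intro b
    obtain ⟨a, n, h⟩ := h b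
    refine ⟨IsLocalization.mk' _ a (⟨f ^ n, n, rfl⟩ : Submonoid.powers f), ?_⟩
    rw [← (hf.pow n).mul_right_inj, ← h, ← hψ', ← hψ', ← map_pow, ← map_mul, ← map_pow]
    congr 1
    exact IsLocalization.mk'_spec' _ a (⟨f ^ n, n, rfl⟩ : Submonoid.powers f)
  have h1 : IsClosedImmersion (Spec.map (CommRingCat.ofHom ψ)) :=
    IsClosedImmersion.spec_of_surjective _ hs
  have h2 : IsOpenImmersion (Spec.map (CommRingCat.ofHom (algebraMap A (Localization.Away f)))) :=
    inferInstance
  rw [← hψ, CommRingCat.ofHom_comp, Spec.map_comp]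
  infer_instance

namespace Configuration

attribute [local instance] MvPolynomial.gradedAlgebra

variable {E K : Type} [Field K] {A : Type} [CommRing A] [Algebra K A]

variable (E K) in
/-- The product `ℙ(K^E) × ℙ(K^E)`. -/
abbrev biproj : Scheme.{0} := Limits.pullback (projSpaceHom E K) (projSpaceHom E K)

variable (E K) in
/-- The structure morphism of `ℙ(K^E) × ℙ(K^E)`. -/
def biprojOver : biproj E K ⟶ Spec (.of K) := Limits.pullback.fst _ _ ≫ projSpaceHom E K

/-- The `A`-valued point `([v], [b])` of `ℙ(K^E) × ℙ(K^E)`. -/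
def pairPoint (v b : E → A) (hv : ∃ i, IsUnit (v i)) (hb : ∃ i, IsUnit (b i)) :
    Spec (.of A) ⟶ biproj E K :=
  Limits.pullback.lift (projPoint v hv) (projPoint b hb)
    (by rw [projPoint_projSpaceHom, projPoint_projSpaceHom])

variable (K) in
/-- The locus in `ℙ(K^E) × ℙ(K^E)` where the `i`-th coordinate of the first factor is nonzero. -/
def firstOpen (i : E) : (biproj E K).Opens :=
  (Limits.pullback.fst (projSpaceHom E K) (projSpaceHom E K)) ⁻¹ᵁ
    Proj.basicOpen _ (MvPolynomial.X i)

variable (K) in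
/-- The locus in `ℙ(K^E) × ℙ(K^E)` where the `i`-th coordinate of the second factor is nonzero. -/
def secondOpen (i : E) : (biproj E K).Opens :=
  (Limits.pullback.snd (projSpaceHom E K) (projSpaceHom E K)) ⁻¹ᵁ
    Proj.basicOpen _ (MvPolynomial.X i)

theorem pairPoint_biprojOver (v b : E → A) (hv : ∃ i, IsUnit (v i)) (hb : ∃ i, IsUnit (b i)) :
    pairPoint v b hv hb ≫ biprojOver E K = Spec.map (CommRingCat.ofHom (algebraMap K A)) := by
  rw [pairPoint, biprojOver, Limits.pullback.lift_fst_assoc, projPoint_projSpaceHom]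

theorem pairPoint_mem_firstOpen (v b : E → A) (hv : ∃ i, IsUnit (v i)) (hb : ∃ i, IsUnit (b i))
    (x : Spec (.of A)) (i : E) :
    pairPoint (K := K) v b hv hb x ∈ firstOpen K i ↔ v i ∉ x.asIdeal := by
  change x ∈ pairPoint (K := K) v b hv hb ⁻¹ᵁ firstOpen K i ↔ _
  rw [firstOpen, ← Scheme.Hom.comp_preimage, pairPoint, Limits.pullback.lift_fst,
    projPoint_preimage]
  rfl

theorem pairPoint_mem_secondOpen (v b : E → A) (hv : ∃ i, IsUnit (v i)) (hb : ∃ i, IsUnit (b i))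
    (x : Spec (.of A)) (i : E) :
    pairPoint (K := K) v b hv hb x ∈ secondOpen K i ↔ b i ∉ x.asIdeal := by
  change x ∈ pairPoint (K := K) v b hv hb ⁻¹ᵁ secondOpen K i ↔ _
  rw [secondOpen, ← Scheme.Hom.comp_preimage, pairPoint, Limits.pullback.lift_snd,
    projPoint_preimage]
  rfl

theorem pairPoint_smul (v b : E → A) (hv : ∃ i, IsUnit (v i)) (hb : ∃ i, IsUnit (b i)) (c d : A)
    (hc : IsUnit c) (hd : IsUnit d) (hcv : ∃ i, IsUnit (c * v i)) (hdb : ∃ i, IsUnit (d * b i)) :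
    pairPoint (K := K) (fun i => c * v i) (fun i => d * b i) hcv hdb = pairPoint v b hv hb := by
  simp only [pairPoint, projPoint_smul v c hc hv hcv, projPoint_smul b d hd hb hdb]

theorem SpecMap_pairPoint {B : Type} [CommRing B] [Algebra K B] (φ : A →ₐ[K] B) (v b : E → A)
    (hv : ∃ i, IsUnit (v i)) (hb : ∃ i, IsUnit (b i)) (hv' : ∃ i, IsUnit (φ (v i)))
    (hb' : ∃ i, IsUnit (φ (b i))) :
    Spec.map (CommRingCat.ofHom φ.toRingHom) ≫ pairPoint (K := K) v b hv hb =
      pairPoint (fun i => φ (v i)) (fun i => φ (b i)) hv' hb' := by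
  apply Limits.pullback.hom_ext
  · rw [Category.assoc, pairPoint, pairPoint, Limits.pullback.lift_fst, Limits.pullback.lift_fst,
      SpecMap_projPoint]
  · rw [Category.assoc, pairPoint, pairPoint, Limits.pullback.lift_snd, Limits.pullback.lift_snd,
      SpecMap_projPoint]

variable (K) in
/-- The coordinate ring of the chart `X_j ≠ 0` of `ℙ(K^E)`. -/
abbrev AwayRing (j : E) : Type :=
  HomogeneousLocalization.Away (MvPolynomial.homogeneousSubmodule E K) (MvPolynomial.X j)

variable (K) in
/-- The inclusion of the chart `X_j ≠ 0` of `ℙ(K^E)`. -/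
abbrev awayChart (j : E) : Spec (.of (AwayRing K j)) ⟶ projSpace E K :=
  Proj.awayι (MvPolynomial.homogeneousSubmodule E K) (MvPolynomial.X j)
        (X_mem_homogeneousSubmodule j) one_pos

instance algebraAwayRing (j : E) : Algebra K (AwayRing K j) :=
  ((HomogeneousLocalization.fromZeroRingHom _ _).comp
    (algebraMap K (MvPolynomial.homogeneousSubmodule E K 0))).toAlgebra

theorem awayChart_projSpaceHom (j : E) : awayChart K j ≫ projSpaceHom E K =
    Spec.map (CommRingCat.ofHom (algebraMap K (AwayRing K j))) := by
  rw [projSpaceHom, ← Category.assoc, Proj.awayι_toSpecZero, ← Spec.map_comp,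
    ← CommRingCat.ofHom_comp]

/-- The evaluation at a vector `v` with `v_j` a unit, as a homomorphism of `K`-algebras. -/
def awayEvalHom (v : E → A) (j : E) (hj : IsUnit (v j)) : AwayRing K j →ₐ[K] A where
  toRingHom := awayEval v j hj
  commutes' c := by
    have h := projPoint_projSpaceHom (K := K) v ⟨j, hj⟩
    rw [projPoint_eq v j hj, Category.assoc, awayChart_projSpaceHom, ← Spec.map_comp,
      ← CommRingCat.ofHom_comp] at h
    exact RingHom.congr_fun (congrArg CommRingCat.Hom.hom (Spec.map_injective h)) c

variable (K) in
/-- The coordinate `X_i / X_j` on the chart `X_j ≠ 0`. -/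
def awayCoord (j i : E) : AwayRing K j :=
  HomogeneousLocalization.Away.mk (MvPolynomial.homogeneousSubmodule E K)
      (X_mem_homogeneousSubmodule j) 1 (MvPolynomial.X i) (X_mem_homogeneousSubmodule i)

theorem awayEvalHom_awayCoord (v : E → A) (j : E) (hj : v j = 1) (i : E) :
    awayEvalHom (K := K) v j (hj ▸ isUnit_one) (awayCoord K j i) = v i := by
  refine (awayEval_eq_iff v j (hj ▸ isUnit_one) _ _).2 ?_
  rw [hj]; simp

open scoped TensorProduct

variable (K) in
/-- The chart `X_j ≠ 0`, `Y_k ≠ 0` of `ℙ(K^E) × ℙ(K^E)`. -/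
def biprojChart (j k : E) : Spec (.of (AwayRing K j ⊗[K] AwayRing K k)) ⟶ biproj E K :=
  (pullbackSpecIso K (AwayRing K j) (AwayRing K k)).inv ≫
    Limits.pullback.map _ _ _ _ (awayChart K j) (awayChart K k) (𝟙 _)
      (by rw [awayChart_projSpaceHom, Category.comp_id])
      (by rw [awayChart_projSpaceHom, Category.comp_id])

instance (j k : E) : IsOpenImmersion (biprojChart K j k) := by
  unfold biprojChart
  infer_instance

theorem range_biprojChart (j k : E) :
    Set.range (biprojChart K j k) = (firstOpen K j : Set (biproj E K)) ∩ secondOpen K k := by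
  rw [biprojChart, Scheme.Hom.comp_base, TopCat.coe_comp, Set.range_comp,
    Set.range_eq_univ.2 (pullbackSpecIso K (AwayRing K j) (AwayRing K k)).inv.surjective,
    Set.image_univ, Scheme.Pullback.range_map]
  congr 1
  · change _ = Limits.pullback.fst (projSpaceHom E K) (projSpaceHom E K) ⁻¹' (Proj.basicOpen _ _).1
    rw [← Proj.opensRange_awayι _ _ (X_mem_homogeneousSubmodule j) one_pos]
    rfl
  · change _ = Limits.pullback.snd (projSpaceHom E K) (projSpaceHom E K) ⁻¹' (Proj.basicOpen _ _).1
    rw [← Proj.opensRange_awayι _ _ (X_mem_homogeneousSubmodule k) one_pos]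
    rfl

theorem pairPoint_eq (v b : E → A) {j k : E} (hv : IsUnit (v j)) (hb : IsUnit (b k)) :
    pairPoint (K := K) v b ⟨j, hv⟩ ⟨k, hb⟩ = Spec.map (CommRingCat.ofHom
      (Algebra.TensorProduct.productMap (awayEvalHom v j hv) (awayEvalHom b k hb)).toRingHom) ≫
        biprojChart K j k := by
  apply Limits.pullback.hom_ext
  · rw [pairPoint, Limits.pullback.lift_fst, biprojChart, Category.assoc, Category.assoc,
      Limits.pullback.map, Limits.pullback.lift_fst, pullbackSpecIso_inv_fst_assoc,
      ← Spec.map_comp_assoc, ← CommRingCat.ofHom_comp, projPoint_eq v j hv]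
    congr 3
    exact congrArg AlgHom.toRingHom (Algebra.TensorProduct.productMap_left
      (awayEvalHom v j hv) (awayEvalHom b k hb)).symm
  · rw [pairPoint, Limits.pullback.lift_snd, biprojChart, Category.assoc, Category.assoc,
      Limits.pullback.map, Limits.pullback.lift_snd, pullbackSpecIso_inv_snd_assoc,
      ← Spec.map_comp_assoc, ← CommRingCat.ofHom_comp, projPoint_eq b k hb]
    congr 3
    exact congrArg AlgHom.toRingHom (Algebra.TensorProduct.productMap_right
      (awayEvalHom v j hv) (awayEvalHom b k hb)).symm

/-- For normalized vectors, the evaluation at `(v, b)` factors through the coordinate ring of the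
chart. -/
theorem exists_productMap_comp (v b : E → A) {j k : E} (hv : v j = 1) (hb : b k = 1) :
    ∃ s : MvPolynomial (E ⊕ E) K →ₐ[K] AwayRing K j ⊗[K] AwayRing K k,
      (Algebra.TensorProduct.productMap (awayEvalHom v j (hv ▸ isUnit_one))
        (awayEvalHom b k (hb ▸ isUnit_one))).comp s = MvPolynomial.aeval (Sum.elim v b) := by
  refine ⟨MvPolynomial.aeval (Sum.elim (fun i => awayCoord K j i ⊗ₜ 1)
    (fun i => 1 ⊗ₜ awayCoord K k i)), ?_⟩
  refine MvPolynomial.algHom_ext fun i => ?_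
  obtain i | i := i
  · simp [awayEvalHom_awayCoord v j hv]
  · simp [awayEvalHom_awayCoord b k hb]

/-- A point normalized by `v_j = b_k = 1` is an immersion if its coordinates generate the algebra
after inverting a polynomial in the coordinates that is already a unit. -/
theorem isImmersion_pairPoint (v b : E → A) {j k : E} (hv : v j = 1) (hb : b k = 1)
    (f : MvPolynomial (E ⊕ E) K) (hf : IsUnit (MvPolynomial.aeval (Sum.elim v b) f))
    (h : ∀ a : A, ∃ p n, MvPolynomial.aeval (R := K) (Sum.elim v b) p =
      MvPolynomial.aeval (Sum.elim v b) f ^ n * a) :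
    IsImmersion (pairPoint (K := K) v b ⟨j, hv ▸ isUnit_one⟩ ⟨k, hb ▸ isUnit_one⟩) := by
  obtain ⟨s, hs⟩ := exists_productMap_comp (K := K) v b hv hb
  rw [pairPoint_eq v b (hv ▸ isUnit_one) (hb ▸ isUnit_one)]
  rw [← hs] at hf h
  have := isImmersion_SpecMap_of_forall_exists (Algebra.TensorProduct.productMap
    (awayEvalHom v j (hv ▸ isUnit_one)) (awayEvalHom b k (hb ▸ isUnit_one))).toRingHom (s f) hf
    (fun a => by obtain ⟨p, n, h⟩ := h a; exact ⟨s p, n, h⟩)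
  infer_instance

/-- A point normalized by `v_j = b_k = 1` whose coordinates generate the algebra has closed image
in the chart `X_j ≠ 0`, `Y_k ≠ 0`. -/
theorem exists_isClosed_range_pairPoint (v b : E → A) {j k : E} (hv : v j = 1) (hb : b k = 1)
    (h : Function.Surjective (MvPolynomial.aeval (R := K) (Sum.elim v b))) :
    ∃ C : Set (biproj E K), IsClosed C ∧
      Set.range (pairPoint (K := K) v b ⟨j, hv ▸ isUnit_one⟩ ⟨k, hb ▸ isUnit_one⟩) =
        C ∩ (firstOpen K j ∩ secondOpen K k) := by
  obtain ⟨s, hs⟩ := exists_productMap_comp (K := K) v b hv hb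
  rw [pairPoint_eq v b (hv ▸ isUnit_one) (hb ▸ isUnit_one)]
  set φ := Algebra.TensorProduct.productMap
    (awayEvalHom (K := K) v j (hv ▸ isUnit_one)) (awayEvalHom b k (hb ▸ isUnit_one))
  have hφ : Function.Surjective φ.toRingHom := by
    rw [← hs] at h
    exact Function.Surjective.of_comp h
  have := IsClosedImmersion.spec_of_surjective (CommRingCat.ofHom φ.toRingHom) hφ
  have hc := (Spec.map (CommRingCat.ofHom φ.toRingHom)).isClosedEmbedding.isClosed_range
  obtain ⟨C, hC, hCr⟩ := (biprojChart K j k).isEmbedding.isInducing.isClosed_iff.1 hc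
  refine ⟨C, hC, ?_⟩
  rw [Scheme.Hom.comp_base, TopCat.coe_comp, Set.range_comp, ← hCr,
    Set.image_preimage_eq_inter_range, range_biprojChart]

end Configuration

/-! ### The points of Bloch's incidence variety -/

namespace Configuration

attribute [local instance] MvPolynomial.gradedAlgebra

variable {E K : Type} [Field K] {A : Type} [CommRing A] [Algebra K A]

theorem isVariety_biprojOver [Fintype E] :
    GrothendieckRing.isVariety K (Over.mk (biprojOver E K)) := by
  have : IsProper (biprojOver E K) := by unfold biprojOver; infer_instance
  exact ⟨inferInstanceAs (LocallyOfFiniteType (biprojOver E K)),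
    inferInstanceAs (QuasiCompact (biprojOver E K)), inferInstanceAs (IsSeparated (biprojOver E K))⟩

theorem iSup_basicOpen_X :
    ⨆ i : E, Proj.basicOpen (MvPolynomial.homogeneousSubmodule E K) (MvPolynomial.X i) = ⊤ := by
  refine Proj.iSup_basicOpen_eq_top' _ _ (fun i => ⟨1, X_mem_homogeneousSubmodule i⟩) ?_
  refine top_unique fun p _ => ?_
  induction p using MvPolynomial.induction_on with
  | C c =>
    exact Subalgebra.algebraMap_mem _ (algebraMap K (MvPolynomial.homogeneousSubmodule E K 0) c)
  | add p q hp hq => exact add_mem (hp trivial) (hq trivial)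
  | mul_X p i hp => exact mul_mem (hp trivial) (Algebra.subset_adjoin ⟨i, rfl⟩)

theorem exists_mem_firstOpen (x : biproj E K) : ∃ j, x ∈ firstOpen K j := by
  have h : Limits.pullback.fst (projSpaceHom E K) (projSpaceHom E K) x ∈
      (⊤ : (projSpace E K).Opens) := trivial
  rw [← iSup_basicOpen_X, TopologicalSpace.Opens.mem_iSup] at h
  exact h

theorem exists_mem_secondOpen (x : biproj E K) : ∃ j, x ∈ secondOpen K j := by
  have h : Limits.pullback.snd (projSpaceHom E K) (projSpaceHom E K) x ∈
      (⊤ : (projSpace E K).Opens) := trivial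
  rw [← iSup_basicOpen_X, TopologicalSpace.Opens.mem_iSup] at h
  exact h

/-- The quotient algebra by `J`, of which only the universal property is recorded. -/
theorem exists_surjective_algHom_ker_eq (J : Ideal A) :
    ∃ (S : Type) (_ : CommRing S) (_ : Algebra K S) (π : A →ₐ[K] S),
      Function.Surjective π ∧ RingHom.ker π = J :=
  ⟨A ⧸ J, inferInstance, inferInstance, Ideal.Quotient.mkₐ K J, Ideal.Quotient.mkₐ_surjective K J,
    Ideal.Quotient.mkₐ_ker K J⟩

/-- A point of `ℙ(K^E) × ℙ(K^E)` given by a specialization of the pair `(v, b)` lies in the image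
of `([v], [b])`. -/
theorem pairPoint_mem_range {B : Type} [CommRing B] [Algebra K B] {v b : E → A} {v' b' : E → B}
    (φ : A →ₐ[K] B) (hφv : ∀ i, φ (v i) = v' i) (hφb : ∀ i, φ (b i) = b' i)
    (hv : ∃ i, IsUnit (v i)) (hb : ∃ i, IsUnit (b i)) (hv' : ∃ i, IsUnit (v' i))
    (hb' : ∃ i, IsUnit (b' i)) (y : Spec (.of B)) :
    pairPoint (K := K) v' b' hv' hb' y ∈ Set.range (pairPoint (K := K) v b hv hb) := by
  obtain rfl : (fun i => φ (v i)) = v' := funext hφv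
  obtain rfl : (fun i => φ (b i)) = b' := funext hφb
  rw [← SpecMap_pairPoint φ v b hv hb]
  exact ⟨_, rfl⟩

/-- Every point of `Spec A` is the image of the point of the spectrum of its residue field. -/
theorem exists_SpecMap_residueField_eq (x : PrimeSpectrum A) :
    ∃ y : Spec (.of x.asIdeal.ResidueField),
      Spec.map (CommRingCat.ofHom (algebraMap A x.asIdeal.ResidueField)) y = x := by
  refine ⟨⟨⊥, Ideal.isPrime_bot⟩, ?_⟩
  refine PrimeSpectrum.ext ?_
  exact (Ideal.ker_algebraMap_residueField x.asIdeal)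

variable [Fintype E] (W : Submodule K (E → K))

/-- The vector `v ∈ A^E` satisfies the linear equations of `W ⊆ K^E`, that is, it is an `A`-valued
point of `W`. -/
def LiesIn (v : E → A) : Prop :=
  ∀ φ : E → K, (∀ w ∈ W, ∑ i, φ i * w i = 0) → ∑ i, algebraMap K A (φ i) * v i = 0

/-- The pair `(v, b)` of vectors in `A^E` is an `A`-valued point of the affine incidence variety. -/
structure IsIncident (v b : E → A) : Prop where
  liesIn : LiesIn W v
  orthogonal : ∀ u ∈ W, ∑ i, algebraMap K A (u i) * (v i * b i) = 0

variable {W}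

theorem isIncident_iff (v b : E → A) : IsIncident W v b ↔
    ∀ p ∈ incidenceIdeal W, MvPolynomial.aeval (Sum.elim v b) p = 0 := by
  constructor
  · rintro ⟨h1, h2⟩ p hp
    have : incidenceIdeal W ≤ RingHom.ker (MvPolynomial.aeval (R := K) (Sum.elim v b)) := by
      refine Ideal.span_le.2 ?_
      rintro _ (⟨φ, hφ, rfl⟩ | ⟨u, hu, rfl⟩)
      · simpa [RingHom.mem_ker] using h1 φ hφ
      · simpa [RingHom.mem_ker] using h2 u hu
    exact this hp
  · intro h
    refine ⟨fun φ hφ => ?_, fun u hu => ?_⟩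
    · simpa using h _ (Ideal.subset_span (Or.inl ⟨φ, hφ, rfl⟩))
    · simpa using h _ (Ideal.subset_span (Or.inr ⟨u, hu, rfl⟩))

theorem IsIncident.map {B : Type} [CommRing B] [Algebra K B] {v b : E → A}
    (h : IsIncident W v b) (φ : A →ₐ[K] B) :
    IsIncident W (fun i => φ (v i)) (fun i => φ (b i)) := by
  refine ⟨fun ψ hψ => ?_, fun u hu => ?_⟩
  · simpa using congrArg φ (h.liesIn ψ hψ)
  · simpa using congrArg φ (h.orthogonal u hu)

theorem IsIncident.smul {v b : E → A} (h : IsIncident W v b) (c d : A) :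
    IsIncident W (fun i => c * v i) (fun i => d * b i) := by
  refine ⟨fun ψ hψ => ?_, fun u hu => ?_⟩
  · have := congrArg (fun z => c * z) (h.liesIn ψ hψ)
    rw [← mul_zero c, ← this, Finset.mul_sum]
    exact Finset.sum_congr rfl fun i _ => by ring
  · have := congrArg (fun z => c * d * z) (h.orthogonal u hu)
    rw [← mul_zero (c * d), ← this, Finset.mul_sum]
    exact Finset.sum_congr rfl fun i _ => by ring

theorem isIncident_coord : IsIncident W (wCoord W) (bCoord W) := by
  rw [isIncident_iff]
  intro p hp
  have h : MvPolynomial.aeval (Sum.elim (wCoord W) (bCoord W)) =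
      Ideal.Quotient.mkₐ K (incidenceIdeal W) := by
    refine MvPolynomial.algHom_ext fun i => ?_
    obtain i | i := i <;> simp [wCoord, bCoord]
  rw [h]
  exact Ideal.Quotient.eq_zero_iff_mem.2 hp

/-- The evaluation of functions on the affine incidence variety at an `A`-valued point. -/
def IsIncident.lift {v b : E → A} (h : IsIncident W v b) : CoordRing W →ₐ[K] A :=
  Ideal.Quotient.liftₐ (incidenceIdeal W) (MvPolynomial.aeval (Sum.elim v b))
    ((isIncident_iff v b).1 h)

theorem IsIncident.lift_wCoord {v b : E → A} (h : IsIncident W v b) (i : E) :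
    h.lift (wCoord W i) = v i := by
  refine (Ideal.Quotient.lift_mk _ _ _).trans ?_
  simp

theorem IsIncident.lift_bCoord {v b : E → A} (h : IsIncident W v b) (i : E) :
    h.lift (bCoord W i) = b i := by
  refine (Ideal.Quotient.lift_mk _ _ _).trans ?_
  simp

variable (W) in
/-- The set of points of `ℙV × ℙV*` underlying Bloch's incidence variety. -/
def incidenceSet : Set (biproj E K) := ⋃ jk, Set.range (chartHom W jk)

theorem isUnit_chart (jk : E × E) :
    IsUnit (algebraMap (CoordRing W) (ChartRing W jk) (wCoord W jk.1)) ∧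
      IsUnit (algebraMap (CoordRing W) (ChartRing W jk) (bCoord W jk.2)) := by
  have h : IsUnit (algebraMap (CoordRing W) (ChartRing W jk) (wCoord W jk.1) *
      algebraMap (CoordRing W) (ChartRing W jk) (bCoord W jk.2)) := by
    rw [← map_mul]; exact IsLocalization.Away.algebraMap_isUnit _
  exact ⟨isUnit_of_mul_isUnit_left h, isUnit_of_mul_isUnit_right h⟩

theorem chartHom_eq (jk : E × E) : chartHom W jk =
    pairPoint (fun i => algebraMap (CoordRing W) (ChartRing W jk) (wCoord W i))
      (fun i => algebraMap (CoordRing W) (ChartRing W jk) (bCoord W i))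
      ⟨jk.1, (isUnit_chart jk).1⟩ ⟨jk.2, (isUnit_chart jk).2⟩ := rfl

theorem range_pairPoint_subset {v b : E → A} (h : IsIncident W v b) (hv : ∃ i, IsUnit (v i))
    (hb : ∃ i, IsUnit (b i)) : Set.range (pairPoint (K := K) v b hv hb) ⊆ incidenceSet W := by
  obtain ⟨j, hj⟩ := hv
  obtain ⟨k, hk⟩ := hb
  have hu : IsUnit (h.lift (wCoord W j * bCoord W k)) := by
    rw [map_mul, h.lift_wCoord, h.lift_bCoord]
    exact hj.mul hk
  let ψ : ChartRing W (j, k) →ₐ[K] A :=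
    IsLocalization.liftAlgHom (M := Submonoid.powers (wCoord W j * bCoord W k)) (f := h.lift)
      (by rintro ⟨_, n, rfl⟩; simpa using hu.pow n)
  have hψ : ∀ a, ψ (algebraMap _ _ a) = h.lift a := fun a => by
    simp [ψ, IsLocalization.liftAlgHom_apply]
  have e := SpecMap_pairPoint ψ
    (fun i => algebraMap (CoordRing W) (ChartRing W (j, k)) (wCoord W i))
    (fun i => algebraMap (CoordRing W) (ChartRing W (j, k)) (bCoord W i))
    ⟨j, (isUnit_chart (W := W) (j, k)).1⟩ ⟨k, (isUnit_chart (W := W) (j, k)).2⟩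
    ⟨j, IsUnit.map ψ (isUnit_chart (W := W) (j, k)).1⟩
    ⟨k, IsUnit.map ψ (isUnit_chart (W := W) (j, k)).2⟩
  simp only [hψ, h.lift_wCoord, h.lift_bCoord] at e
  rw [← e]
  refine Set.Subset.trans ?_ (Set.subset_iUnion _ (j, k))
  rw [Scheme.Hom.comp_base, TopCat.coe_comp]
  exact Set.range_comp_subset_range _ _

/-- Every point of the incidence set comes from a pair of vectors over a field, and nonzero
coordinates can be normalized to `1`. -/
theorem exists_field_point {x : biproj E K} (hx : x ∈ incidenceSet W) {j k : E}
    (hj : x ∈ firstOpen K j) (hk : x ∈ secondOpen K k) :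
    ∃ (κ : Type) (_ : Field κ) (_ : Algebra K κ) (v b : E → κ) (hv : v j = 1) (hb : b k = 1)
      (y : Spec (.of κ)), IsIncident W v b ∧
      pairPoint (K := K) v b ⟨j, hv ▸ isUnit_one⟩ ⟨k, hb ▸ isUnit_one⟩ y = x := by
  obtain ⟨jk, z', rfl⟩ := Set.mem_iUnion.1 hx
  let z : PrimeSpectrum (ChartRing W jk) := z'
  obtain ⟨y, hy⟩ := exists_SpecMap_residueField_eq z
  let φ : ChartRing W jk →ₐ[K] z.asIdeal.ResidueField := IsScalarTower.toAlgHom _ _ _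
  have hφ : φ.toRingHom = algebraMap _ _ := rfl
  let v : E → z.asIdeal.ResidueField := fun i => φ (algebraMap _ _ (wCoord W i))
  let b : E → z.asIdeal.ResidueField := fun i => φ (algebraMap _ _ (bCoord W i))
  have hv : ∃ i, IsUnit (v i) := ⟨jk.1, (isUnit_chart jk).1.map φ⟩
  have hb : ∃ i, IsUnit (b i) := ⟨jk.2, (isUnit_chart jk).2.map φ⟩
  have hinc : IsIncident W v b :=
    (isIncident_coord.map (IsScalarTower.toAlgHom K (CoordRing W) (ChartRing W jk))).map φ
  have e := SpecMap_pairPoint φ _ _ ⟨jk.1, (isUnit_chart jk).1⟩ ⟨jk.2, (isUnit_chart jk).2⟩ hv hb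
  have e' : pairPoint (K := K) v b hv hb y = chartHom W jk z' := by
    rw [chartHom_eq]
    refine Eq.trans (congrArg (fun f => f y) (congrArg (fun f => f.base.hom) e.symm)) ?_
    exact congrArg (fun t => chartHom W jk t) hy
  have h0 : ∀ c : z.asIdeal.ResidueField, c ∉ y.asIdeal → c ≠ 0 := by
    rintro c hc rfl
    exact hc (zero_mem _)
  have hvj : v j ≠ 0 := h0 _ ((pairPoint_mem_firstOpen v b hv hb y j).1 (by rwa [e']))
  have hbk : b k ≠ 0 := h0 _ ((pairPoint_mem_secondOpen v b hv hb y k).1 (by rwa [e']))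
  refine ⟨z.asIdeal.ResidueField, inferInstance, inferInstance, fun i => (v j)⁻¹ * v i,
    fun i => (b k)⁻¹ * b i, inv_mul_cancel₀ hvj, inv_mul_cancel₀ hbk, y, hinc.smul _ _, ?_⟩
  rw [← e', pairPoint_smul v b hv hb _ _ (inv_ne_zero hvj).isUnit (inv_ne_zero hbk).isUnit]

/-- In each chart of `ℙV × ℙV*` the incidence set is the image of the slice `w_j = β_k = 1` of the
affine incidence variety. -/
theorem exists_isClosed_incidenceSet_inter_of_slice {S : Type} [CommRing S] [Algebra K S]
    (π : CoordRing W →ₐ[K] S) (hπ : Function.Surjective π) (j k : E)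
    (hker : RingHom.ker π = Ideal.span {wCoord W j - 1, bCoord W k - 1}) :
    ∃ C : Set (biproj E K), IsClosed C ∧
    incidenceSet W ∩ (firstOpen K j ∩ secondOpen K k) = C ∩ (firstOpen K j ∩ secondOpen K k) := by
  have hv : π (wCoord W j) = 1 := by
    rw [← sub_eq_zero, ← map_one π, ← map_sub, ← RingHom.mem_ker, hker]
    exact Ideal.subset_span (by simp)
  have hb : π (bCoord W k) = 1 := by
    rw [← sub_eq_zero, ← map_one π, ← map_sub, ← RingHom.mem_ker, hker]
    exact Ideal.subset_span (by simp)
  have hs : Function.Surjective (MvPolynomial.aeval (R := K)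
      (Sum.elim (fun i => π (wCoord W i)) (fun i => π (bCoord W i)))) := by
    have h : MvPolynomial.aeval (R := K)
        (Sum.elim (fun i => π (wCoord W i)) (fun i => π (bCoord W i))) =
        π.comp (Ideal.Quotient.mkₐ K (incidenceIdeal W)) := by
      refine MvPolynomial.algHom_ext fun i => ?_
      obtain i | i := i <;> simp [wCoord, bCoord]
    rw [h]
    exact hπ.comp (Ideal.Quotient.mkₐ_surjective K _)
  obtain ⟨C, hC, hr⟩ := exists_isClosed_range_pairPoint (K := K) (fun i => π (wCoord W i))
    (fun i => π (bCoord W i)) (j := j) (k := k) hv hb hs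
  refine ⟨C, hC, ?_⟩
  rw [← hr]
  apply Set.Subset.antisymm
  · rintro x ⟨hx, hj, hk⟩
    obtain ⟨κ, _, _, v, b, hvj, hbk, y, hinc, rfl⟩ := exists_field_point hx hj hk
    have hJ : ∀ a, π a = 0 → hinc.lift a = 0 := by
      have : Ideal.span {wCoord W j - 1, bCoord W k - 1} ≤ RingHom.ker hinc.lift := by
        refine Ideal.span_le.2 ?_
        rintro _ (rfl | rfl)
        · simp [RingHom.mem_ker, hinc.lift_wCoord, hvj]
        · simp [RingHom.mem_ker, hinc.lift_bCoord, hbk]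
      rw [← hker] at this
      exact fun a ha => this ha
    have hlift : ∀ a, AlgHom.liftOfSurjective π hπ hinc.lift hJ (π a) = hinc.lift a :=
      fun a => AlgHom.liftOfSurjective_apply _ _ _ _ _
    exact pairPoint_mem_range (AlgHom.liftOfSurjective π hπ hinc.lift hJ)
      (fun i => (hlift _).trans (hinc.lift_wCoord i))
      (fun i => (hlift _).trans (hinc.lift_bCoord i)) _ _ _ _ y
  · exact Set.subset_inter (range_pairPoint_subset (isIncident_coord.map π) _ _)
      (hr ▸ Set.inter_subset_right)

theorem exists_isClosed_incidenceSet_inter (j k : E) : ∃ C : Set (biproj E K), IsClosed C ∧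
    incidenceSet W ∩ (firstOpen K j ∩ secondOpen K k) =
      C ∩ (firstOpen K j ∩ secondOpen K k) := by
  obtain ⟨S, _, _, π, hπ, hker⟩ := exists_surjective_algHom_ker_eq (K := K)
    (Ideal.span {wCoord W j - 1, bCoord W k - 1})
  exact exists_isClosed_incidenceSet_inter_of_slice π hπ j k hker

theorem isClosed_incidenceSet : IsClosed (incidenceSet W) := by
  rw [← isOpen_compl_iff, isOpen_iff_forall_mem_open]
  intro x hx
  obtain ⟨j, hj⟩ := exists_mem_firstOpen x
  obtain ⟨k, hk⟩ := exists_mem_secondOpen x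
  obtain ⟨C, hC, h⟩ := exists_isClosed_incidenceSet_inter (W := W) j k
  refine ⟨Cᶜ ∩ (firstOpen K j ∩ secondOpen K k), ?_,
    hC.isOpen_compl.inter ((firstOpen K j).2.inter (secondOpen K k).2), ?_, hj, hk⟩
  · rintro y ⟨hy, hy'⟩ hyW
    exact hy (h.subset ⟨hyW, hy'⟩).1
  · intro hxC
    exact hx (h.symm.subset ⟨hxC, hj, hk⟩).1

theorem range_biprojHom : Set.range (biprojHom W) = incidenceSet W := by
  apply Set.Subset.antisymm
  · rintro _ ⟨x, rfl⟩
    obtain ⟨jk, y, rfl⟩ := (sigmaOpenCover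
      fun jk : E × E => Spec (.of (ChartRing W jk))).exists_eq x
    refine Set.mem_iUnion.2 ⟨jk, y, ?_⟩
    have h : Limits.Sigma.ι (fun jk : E × E => Spec (.of (ChartRing W jk))) jk ≫ biprojHom W =
      chartHom W jk := Limits.Sigma.ι_desc _ _
    rw [← h]
    rfl
  · refine Set.iUnion_subset fun jk => ?_
    have h : Limits.Sigma.ι (fun jk : E × E => Spec (.of (ChartRing W jk))) jk ≫ biprojHom W =
      chartHom W jk := Limits.Sigma.ι_desc _ _
    rw [← h, Scheme.Hom.comp_base, TopCat.coe_comp]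
    exact Set.range_comp_subset_range _ _

/-- The scheme-theoretic image `Λ_W` adds no points to the image of the charts, as that is already
closed. -/
theorem range_imageι_biprojHom : Set.range (biprojHom W).imageι = incidenceSet W := by
  have := GrothendieckRing.isNoetherian_of_isVariety (isVariety_biprojOver (E := E) (K := K))
  have : QuasiCompact (biprojHom W) := by infer_instance
  rw [Scheme.IdealSheafData.range_subschemeι, Scheme.Hom.support_ker, range_biprojHom,
    isClosed_incidenceSet.closure_eq]

/-- The class of `Λ_W` is the class of its underlying closed set in `ℙV × ℙV*`. -/
theorem cls_lambdaHom_eq_setClass : GrothendieckRing.cls (lambdaHom W) =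
    GrothendieckRing.setClass (biprojOver E K) (incidenceSet W) := by
  rw [GrothendieckRing.cls_eq_schemeClass, ← range_imageι_biprojHom,
    GrothendieckRing.setClass_range isVariety_biprojOver]
  rfl

end Configuration

/-! ### Ranks in the matroid of a configuration -/

namespace Matroid

variable {α : Type*} (M : Matroid α)

theorem eRk_contract_add_eRk (F : Set α) {X : Set α} (hX : Disjoint X F) :
    (M.contract F).eRk X + M.eRk F = M.eRk (F ∪ X) := by
  obtain ⟨J, hJ⟩ := M.exists_isBasis' F
  obtain ⟨I, hI, hJI⟩ := hJ.indep.subset_isBasis'_of_subset (hJ.subset.trans Set.subset_union_left)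
    (X := F ∪ X)
  have hIF : I ∩ F = J := (hJ.eq_of_subset_indep (hI.indep.subset Set.inter_subset_left)
    (Set.subset_inter hJI hJ.subset) Set.inter_subset_right).symm
  have h := hI.contract_isBasis' hJ (hI.indep.subset (Set.union_subset Set.sdiff_subset hJI))
  rw [Set.union_sdiff_left, hX.sdiff_eq_left] at h
  rw [h.eRk_eq_encard, hJ.eRk_eq_encard, hI.eRk_eq_encard, ← hIF, Set.encard_sdiff_add_encard_inter]

end Matroid

namespace Configuration

variable {E K : Type} [Fintype E] [Field K] (W : Submodule K (E → K))

theorem matroid_indep_iff (I : Set E) :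
    (matroid W).Indep I ↔ LinearIndepOn K (coordFn W) I := Iff.rfl

theorem span_image_eq_of_isBasis {I X : Set E} (h : (matroid W).IsBasis I X) :
    Submodule.span K (coordFn W '' X) = Submodule.span K (coordFn W '' I) := by
  refine le_antisymm (Submodule.span_le.2 ?_) (Submodule.span_mono (Set.image_mono h.subset))
  rintro _ ⟨e, he, rfl⟩
  by_contra hn
  have h1 : (matroid W).Indep (insert e I) :=
    LinearIndepOn.insert ((matroid_indep_iff W I).1 h.indep) hn
  exact hn (Submodule.subset_span ⟨e, h.mem_of_insert_indep he h1, rfl⟩)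

theorem exists_isBasis_matroid (X : Set E) : ∃ I, (matroid W).IsBasis I X :=
  (matroid W).exists_isBasis X (Set.subset_univ X)

theorem mem_closure_matroid_iff (X : Set E) (e : E) :
    e ∈ (matroid W).closure X ↔ coordFn W e ∈ Submodule.span K (coordFn W '' X) := by
  obtain ⟨I, hI⟩ := exists_isBasis_matroid W X
  rw [← hI.closure_eq_closure, span_image_eq_of_isBasis W hI, hI.indep.mem_closure_iff',
    matroid_indep_iff]
  have hI' := (matroid_indep_iff W I).1 hI.indep
  constructor
  · rintro ⟨-, h⟩
    by_contra hn
    exact hn (Submodule.subset_span ⟨e, h (hI'.insert hn), rfl⟩)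
  · intro h
    refine ⟨Set.mem_univ e, fun h1 => ?_⟩
    by_contra he
    exact ((linearIndepOn_insert he).1 h1).2 h

theorem eRk_matroid (X : Set E) :
    (matroid W).eRk X = (Module.finrank K (Submodule.span K (coordFn W '' X)) : ℕ) := by
  obtain ⟨I, hI⟩ := exists_isBasis_matroid W X
  have := Fintype.ofFinite I
  rw [hI.eRk_eq_encard, span_image_eq_of_isBasis W hI, Set.image_eq_range,
    finrank_span_eq_card (b := fun i : I => coordFn W i) hI.indep, Set.encard_eq_coe_toFinset_card,
    Set.toFinset_card]

/-- The subspace of vectors of `W` whose coordinates in `A` vanish. -/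
def vanishing (A : Finset E) : Submodule K (E → K) where
  carrier := {w | w ∈ W ∧ ∀ i ∈ A, w i = 0}
  add_mem' ha hb := ⟨W.add_mem ha.1 hb.1, fun i hi => by simp [ha.2 i hi, hb.2 i hi]⟩
  zero_mem' := ⟨W.zero_mem, fun _ _ => rfl⟩
  smul_mem' c _ ha := ⟨W.smul_mem c ha.1, fun i hi => by simp [ha.2 i hi]⟩

variable {W} in
omit [Fintype E] in
theorem mem_vanishing {A : Finset E} {w : E → K} :
    w ∈ vanishing W A ↔ w ∈ W ∧ ∀ i ∈ A, w i = 0 := Iff.rfl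

theorem finrank_vanishing (A : Finset E) :
    Module.finrank K (Submodule.span K (coordFn W '' A)) + Module.finrank K (vanishing W A) =
      Module.finrank K W := by
  rw [← Subspace.finrank_add_finrank_dualCoannihilator_eq
    (Submodule.span K (coordFn W '' (A : Set E)))]
  congr 1
  have h : vanishing W A =
      (Submodule.span K (coordFn W '' (A : Set E))).dualCoannihilator.map W.subtype := by
    ext w
    simp only [mem_vanishing, Submodule.mem_map, Submodule.mem_dualCoannihilator]
    constructor
    · rintro ⟨hw, h⟩
      refine ⟨⟨w, hw⟩, fun φ hφ => ?_, rfl⟩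
      have : Submodule.span K (coordFn W '' (A : Set E)) ≤
          LinearMap.ker (Module.Dual.eval K W ⟨w, hw⟩) := by
        rw [Submodule.span_le]
        rintro _ ⟨i, hi, rfl⟩
        exact h i hi
      exact this hφ
    · rintro ⟨w, h, rfl⟩
      exact ⟨w.2, fun i hi => h _ (Submodule.subset_span ⟨i, hi, rfl⟩)⟩
  rw [h]
  exact (Submodule.equivMapOfInjective W.subtype W.injective_subtype _).finrank_eq.symm

/-- The exponents in the characteristic polynomial of `M / F` are the dimensions of the subspaces
of `W` cut out by vanishing of coordinates. -/
theorem eRank_contract_sub_eRk [DecidableEq E] {F A : Finset E} (hA : Disjoint A F) :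
    ((matroid W).contract F).eRank.toNat - (((matroid W).contract F).eRk (A : Set E)).toNat =
      Module.finrank K (vanishing W (F ∪ A)) := by
  have h1 := (matroid W).eRk_contract_add_eRk F (X := (A : Set E)) (by exact_mod_cast hA)
  have h2 := (matroid W).eRk_contract_add_eRk F (X := (F : Set E)ᶜ) disjoint_compl_left
  have hE : ((matroid W).contract F).eRk (F : Set E)ᶜ = ((matroid W).contract F).eRank := by
    rw [← Matroid.eRk_ground]
    congr 1
    exact (Set.compl_eq_univ_sdiff _)
  rw [hE] at h2
  rw [eRk_matroid, eRk_matroid] at h1 h2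
  have h3 := finrank_vanishing W (F ∪ A)
  have h4 := finrank_vanishing W (Finset.univ)
  have h5 : vanishing W Finset.univ = ⊥ := by
    refine (Submodule.eq_bot_iff _).2 fun w hw => funext fun i => hw.2 i (Finset.mem_univ i)
  rw [h5, finrank_bot, add_zero, Finset.coe_univ] at h4
  rw [Set.union_compl_self, h4] at h2
  rw [Finset.coe_union] at h3
  have ht : ((matroid W).contract F).eRk (A : Set E) ≠ ⊤ := fun h => by simp [h] at h1
  have ht' : ((matroid W).contract F).eRank ≠ ⊤ := fun h => by simp [h] at h2
  lift ((matroid W).contract F).eRk (A : Set E) to ℕ using ht with a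
  lift ((matroid W).contract F).eRank to ℕ using ht' with b
  norm_cast at h1 h2
  simp only [ENat.toNat_natCast]
  omega

/-- A set `B` of coordinates outside `F`, of size the rank of `M \ F`, together with vectors of `W`
that are dual to `B` and generate the restrictions of vectors of `W` to the complement of `F`. -/
theorem exists_dual_vectors [DecidableEq E] (F : Finset E) :
    ∃ (B : Finset E) (u : E → E → K), Disjoint B F ∧
      B.card = ((matroid W).delete F).eRank.toNat ∧ (∀ b ∈ B, u b ∈ W) ∧
      (∀ b ∈ B, ∀ b' ∈ B, u b b' = if b = b' then 1 else 0) ∧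
      ∀ w ∈ W, ∀ i ∉ F, w i = ∑ b ∈ B, w b * u b i := by
  obtain ⟨B', hB'⟩ := exists_isBasis_matroid W (F : Set E)ᶜ
  obtain ⟨B, rfl⟩ := (Set.toFinite B').exists_finset_coe
  have hli : LinearIndependent K (fun b : (B : Set E) => coordFn W b) := hB'.indep
  -- the coordinates in `B` are independent, so they separate vectors of `W` freely
  have hsurj : ∀ b ∈ B, ∃ w : W, ∀ b' ∈ B, coordFn W b' w = if b = b' then 1 else 0 := by
    intro b hb
    let φ : Submodule.span K (Set.range fun b : (B : Set E) => coordFn W b) →ₗ[K] K :=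
      (Module.Basis.span hli).coord ⟨b, hb⟩
    obtain ⟨ψ, hψ⟩ := φ.exists_extend
    obtain ⟨w, hw⟩ := (Module.evalEquiv K W).surjective ψ
    refine ⟨w, fun b' hb' => ?_⟩
    have h1 : coordFn W b' w = ψ (coordFn W b') := by rw [← hw]; rfl
    have h2 : ψ (coordFn W b') = φ (Module.Basis.span hli ⟨b', hb'⟩) := by
      rw [← hψ, LinearMap.comp_apply, Module.Basis.span_apply]
      rfl
    rw [h1, h2]
    simp only [φ, Module.Basis.coord_apply, Module.Basis.repr_self, Finsupp.single_apply]
    simp [eq_comm]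
  choose! u hu using hsurj
  refine ⟨B, fun b => u b, ?_, ?_, fun b _ => (u b).2, fun b hb b' hb' => hu b hb b' hb', ?_⟩
  · have := hB'.subset
    rw [Set.subset_compl_iff_disjoint_right] at this
    exact_mod_cast this
  · have h1 : ((matroid W).delete (F : Set E)).eRank = (matroid W).eRk (F : Set E)ᶜ := by
      rw [Matroid.delete_eq_restrict, Matroid.eRank_restrict, Set.compl_eq_univ_sdiff]
      rfl
    rw [h1, hB'.eRk_eq_encard, Set.encard_coe_eq_coe_finsetCard, ENat.toNat_natCast]
  · intro w hw i hi
    let z : W := ⟨w, hw⟩ - ∑ b ∈ B, w b • u b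
    have hz : ∀ e, coordFn W e z = w e - ∑ b ∈ B, w b * (u b : E → K) e := by
      intro e
      simp only [z, map_sub, map_sum, map_smul]
      rfl
    have hspan : coordFn W i ∈ Submodule.span K (coordFn W '' (B : Set E)) := by
      rw [← span_image_eq_of_isBasis W hB']
      exact Submodule.subset_span ⟨i, by simpa using hi, rfl⟩
    have hle : Submodule.span K (coordFn W '' (B : Set E)) ≤
        LinearMap.ker (Module.Dual.eval K W z) := by
      rw [Submodule.span_le]
      rintro _ ⟨b, hb, rfl⟩
      change coordFn W b z = 0
      have hb' : ∀ c ∈ B, w c * (u c : E → K) b = if c = b then w c else 0 := by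
        intro c hc
        have : (u c : E → K) b = if c = b then 1 else 0 := hu c hc b hb
        rw [this]; split_ifs <;> simp
      rw [hz, Finset.sum_congr rfl hb', Finset.sum_ite_eq' B b, if_pos (Finset.mem_coe.1 hb),
        sub_self]
    have h0 : coordFn W i z = 0 := hle hspan
    rw [hz, sub_eq_zero] at h0
    exact h0

end Configuration

/-! ### The reduced characteristic polynomial of a contraction -/

namespace Configuration

variable {E K : Type} [Fintype E] [Field K] (W : Submodule K (E → K))

omit [Fintype E] in
theorem vanishing_insert_of_forall [DecidableEq E] {A : Finset E} {j : E}
    (h : ∀ w ∈ vanishing W A, w j = 0) : vanishing W (insert j A) = vanishing W A := by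
  ext w
  simp only [mem_vanishing, Finset.forall_mem_insert]
  exact ⟨fun hw => ⟨hw.1, hw.2.2⟩, fun hw => ⟨hw.1, h w hw, hw.2⟩⟩

theorem finrank_vanishing_insert [DecidableEq E] {A : Finset E} {j : E}
    (h : ∃ w ∈ vanishing W A, w j ≠ 0) :
    Module.finrank K (vanishing W (insert j A)) + 1 = Module.finrank K (vanishing W A) := by
  obtain ⟨w, hw, hwj⟩ := h
  have hne : coordFn (vanishing W A) j ≠ 0 := fun h0 => hwj (LinearMap.congr_fun h0 ⟨w, hw⟩)
  rw [← Module.Dual.finrank_ker_add_one_of_ne_zero hne]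
  congr 1
  have hmap : vanishing W (insert j A) =
      (LinearMap.ker (coordFn (vanishing W A) j)).map (vanishing W A).subtype := by
    ext v
    simp only [mem_vanishing, Finset.forall_mem_insert, Submodule.mem_map, LinearMap.mem_ker]
    constructor
    · rintro ⟨hv, hj, hA⟩
      exact ⟨⟨v, hv, hA⟩, hj, rfl⟩
    · rintro ⟨v, hj, rfl⟩
      exact ⟨v.2.1, hj, v.2.2⟩
  rw [hmap]
  exact (Submodule.equivMapOfInjective _ (vanishing W A).injective_subtype _).finrank_eq.symm

open Classical in
/-- The polynomial in `𝕃` that is the class of the affine space `{w ∈ W | w_A = 0, w_j = 1}`,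
which may be empty. If it is not, then the subspace `{w ∈ W | w_A = 0}` has positive dimension, so
that the subtraction does not truncate. -/
def slicePoly (A : Finset E) (j : E) : ℤ[X] :=
  if ∃ w ∈ vanishing W A, w j ≠ 0 then
    Polynomial.X ^ (Module.finrank K (vanishing W A) - 1) else 0

/-- The slice `w_j = 1` meets each line off the hyperplane `w_j = 0` in one point. -/
theorem X_sub_one_mul_slicePoly [DecidableEq E] (A : Finset E) (j : E) :
    (Polynomial.X - Polynomial.C 1) * slicePoly W A j =
      Polynomial.X ^ Module.finrank K (vanishing W A) -
        Polynomial.X ^ Module.finrank K (vanishing W (insert j A)) := by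
  rw [slicePoly]
  split_ifs with h
  · rw [← finrank_vanishing_insert W h, Nat.add_sub_cancel, Polynomial.C_1, pow_succ]
    ring
  · push Not at h
    rw [vanishing_insert_of_forall W h, mul_zero, sub_self]

/-- Inclusion-exclusion for the complement of a hyperplane arrangement in the affine slice `w_j = 1`
computes the reduced characteristic polynomial. -/
theorem reducedCharPoly_contract_eq_sum [DecidableEq E] {F : Finset E} {j : E} (hj : j ∉ F) :
    ((matroid W).contract (F : Set E)).reducedCharPoly =
      ∑ A ∈ Fᶜ.powerset, (-1) ^ A.card * slicePoly W (F ∪ A) j := by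
  have hE : ((matroid W).contract (F : Set E)).E = ((Fᶜ : Finset E) : Set E) := by
    rw [Finset.coe_compl]
    exact (Set.compl_eq_univ_sdiff _).symm
  have hne : ((matroid W).contract (F : Set E)).E.Nonempty := ⟨j, by rw [hE]; simpa using hj⟩
  apply mul_left_cancel₀ (Polynomial.X_sub_C_ne_zero (1 : ℤ))
  rw [Matroid.X_sub_one_mul_reducedCharPoly _ hne, Matroid.charPoly]
  have hfin : (Set.toFinite ((matroid W).contract (F : Set E)).E).toFinset = Fᶜ := by
    ext i
    rw [Set.Finite.mem_toFinset, hE, Finset.mem_coe]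
  rw [hfin, Finset.mul_sum]
  have h1 : ∀ A ∈ Fᶜ.powerset, (-1) ^ A.card * Polynomial.X ^
      (((matroid W).contract (F : Set E)).eRank.toNat -
        (((matroid W).contract (F : Set E)).eRk (A : Set E)).toNat) =
      (-1) ^ A.card * (Polynomial.X : ℤ[X]) ^ Module.finrank K (vanishing W (F ∪ A)) := by
    intro A hA
    rw [eRank_contract_sub_eRk]
    rw [Finset.mem_powerset, Finset.subset_compl_iff_disjoint_right] at hA
    exact hA
  rw [Finset.sum_congr rfl h1]
  have h2 : ∀ A ∈ Fᶜ.powerset, (Polynomial.X - Polynomial.C 1) *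
      ((-1) ^ A.card * slicePoly W (F ∪ A) j) =
      (-1) ^ A.card * (Polynomial.X : ℤ[X]) ^ Module.finrank K (vanishing W (F ∪ A)) -
      (-1) ^ A.card * (Polynomial.X : ℤ[X]) ^ Module.finrank K (vanishing W (F ∪ insert j A)) := by
    intro A _
    rw [mul_left_comm, X_sub_one_mul_slicePoly, Finset.union_insert, mul_sub]
  rw [Finset.sum_congr rfl h2, Finset.sum_sub_distrib, eq_comm, sub_eq_self]
  -- the terms of `A` and `A ∪ {j}` cancel
  have hjF : j ∈ Fᶜ := by simpa using hj
  rw [← Finset.insert_erase hjF, Finset.sum_powerset_insert (Finset.notMem_erase j _),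
    ← Finset.sum_add_distrib]
  refine Finset.sum_eq_zero fun A hA => ?_
  have hjA : j ∉ A := fun h => Finset.notMem_erase j _ (Finset.mem_powerset.1 hA h)
  rw [Finset.card_insert_of_notMem hjA, Finset.insert_idem]
  ring

end Configuration

/-! ### Points of linear subspaces and their affine slices -/

namespace Configuration

variable {E K : Type} [Fintype E] [Field K] (W : Submodule K (E → K)) {A : Type} [CommRing A]
  [Algebra K A]

variable {W}

theorem LiesIn.map {B : Type} [CommRing B] [Algebra K B] {v : E → A} (h : LiesIn W v)
    (φ : A →ₐ[K] B) : LiesIn W (fun i => φ (v i)) := fun ψ hψ => by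
  simpa using congrArg φ (h ψ hψ)

theorem liesIn_algebraMap {w : E → K} (hw : w ∈ W) : LiesIn W (fun i => algebraMap K A (w i)) :=
  fun φ hφ => by simpa using congrArg (algebraMap K A) (hφ w hw)

theorem LiesIn.add {v v' : E → A} (h : LiesIn W v) (h' : LiesIn W v') :
    LiesIn W (fun i => v i + v' i) := fun φ hφ => by
  simp only [mul_add, Finset.sum_add_distrib, h φ hφ, h' φ hφ, add_zero]

theorem LiesIn.sub {v v' : E → A} (h : LiesIn W v) (h' : LiesIn W v') :
    LiesIn W (fun i => v i - v' i) := fun φ hφ => by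
  simp only [mul_sub, Finset.sum_sub_distrib, h φ hφ, h' φ hφ, sub_zero]

theorem LiesIn.mul_left {v : E → A} (h : LiesIn W v) (c : A) :
    LiesIn W (fun i => c * v i) := fun φ hφ => by
  simp only [mul_left_comm, ← Finset.mul_sum, h φ hφ, mul_zero]

theorem LiesIn.sum {ι : Type*} (s : Finset ι) {v : ι → E → A} (h : ∀ b ∈ s, LiesIn W (v b)) :
    LiesIn W (fun i => ∑ b ∈ s, v b i) := fun φ hφ => by
  simp only [Finset.mul_sum]
  rw [Finset.sum_comm]
  exact Finset.sum_eq_zero fun b hb => h b hb φ hφ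

theorem LiesIn.mono {W' : Submodule K (E → K)} (hW : W ≤ W') {v : E → A} (h : LiesIn W v) :
    LiesIn W' v := fun φ hφ => h φ fun w hw => hφ w (hW hw)

/-- An identity that expresses one coordinate of the vectors of `W` through other ones holds for
`A`-valued points as well. -/
theorem LiesIn.eq_sum {v : E → A} (h : LiesIn W v) (B : Finset E) (c : E → K) (i : E)
    (hc : ∀ w ∈ W, w i = ∑ b ∈ B, w b * c b) : v i = ∑ b ∈ B, v b * algebraMap K A (c b) := by
  classical
  have h1 := h (fun e => (if e = i then 1 else 0) - if e ∈ B then c e else 0) (fun w hw => by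
    simp [sub_mul, Finset.sum_sub_distrib, hc w hw, mul_comm (c _)])
  simpa [sub_mul, Finset.sum_sub_distrib, apply_ite (algebraMap K A), sub_eq_zero,
    mul_comm (algebraMap K A _)] using h1

/-- The linear equations of `{w ∈ W | w_A = 0}` are generated by those of `W` and of `A`. -/
theorem LiesIn.vanishing_of_forall {v : E → A} (h : LiesIn W v) (s : Finset E)
    (hs : ∀ i ∈ s, v i = 0) :
    LiesIn (vanishing W s) v := by
  classical
  intro φ hφ
  have e : vanishing W s = W ⊓ vanishing ⊤ s := by
    ext w; simp [mem_vanishing]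
  let Φ : Module.Dual K (E → K) := ∑ i, φ i • LinearMap.proj i
  have hΦ : Φ ∈ (W ⊓ vanishing ⊤ s).dualAnnihilator := by
    rw [Submodule.mem_dualAnnihilator]
    intro w hw
    simpa [Φ] using hφ w (e ▸ hw)
  rw [Subspace.dualAnnihilator_inf_eq, Submodule.mem_sup] at hΦ
  obtain ⟨Φ₁, h₁, Φ₂, h₂, hadd⟩ := hΦ
  rw [Submodule.mem_dualAnnihilator] at h₁ h₂
  have hval : ∀ i, φ i = Φ₁ (Pi.single i 1) + Φ₂ (Pi.single i 1) := by
    intro i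
    rw [← LinearMap.add_apply, hadd]
    simp [Φ, Pi.single_apply]
  have h0 := h (fun i => Φ₁ (Pi.single i 1)) (fun w hw => by
    rw [← h₁ w hw]
    conv_rhs => rw [LinearMap.pi_apply_eq_sum_univ Φ₁ w]
    refine Finset.sum_congr rfl fun i _ => ?_
    rw [smul_eq_mul, mul_comm]
    congr 2
    ext k
    simp [Pi.single_apply, eq_comm])
  rw [← h0]
  refine Finset.sum_congr rfl fun i _ => ?_
  by_cases hi : i ∈ s
  · simp [hs i hi]
  · have : Φ₂ (Pi.single i 1) = 0 := h₂ _ (mem_vanishing.2 ⟨trivial, fun k hk => by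
      rw [Pi.single_apply, if_neg (fun h => hi ((show k = i from h) ▸ hk))]⟩)
    rw [hval, this, add_zero]

theorem eRank_delete_empty : ((matroid W).delete ∅).eRank.toNat = Module.finrank K W := by
  have h4 := finrank_vanishing W Finset.univ
  have h5 : vanishing W Finset.univ = ⊥ :=
    (Submodule.eq_bot_iff _).2 fun w hw => funext fun i => hw.2 i (Finset.mem_univ i)
  rw [h5, finrank_bot, add_zero, Finset.coe_univ] at h4
  have h6 : (matroid W).eRank = (matroid W).eRk Set.univ := (Matroid.eRk_ground _).symm
  rw [Matroid.delete_empty, h6, eRk_matroid, h4, ENat.toNat_natCast]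

/-- A nonempty affine slice `{w ∈ W | w_j = 1}` is an affine space of dimension `dim W - 1`: this
gives its universal point. -/
theorem exists_slice_parametrization {j : E} (hj : ∃ u ∈ W, u j ≠ 0) :
    ∃ (σ : Type) (_ : Fintype σ) (w : E → MvPolynomial σ K),
      Fintype.card σ + 1 = Module.finrank K W ∧ w j = 1 ∧ LiesIn W w ∧
      Function.Surjective (MvPolynomial.aeval (R := K) w) ∧
      ∀ (A : Type) [CommRing A] [Algebra K A] (v : E → A), LiesIn W v → v j = 1 →
        ∃ φ : MvPolynomial σ K →ₐ[K] A, ∀ i, φ (w i) = v i := by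
  classical
  have hfin := finrank_vanishing_insert W (A := ∅) (j := j) (by simpa [mem_vanishing] using hj)
  have hW : vanishing W ∅ = W := by ext; simp [mem_vanishing]
  rw [hW] at hfin
  obtain ⟨u', hu', hu'j⟩ := hj
  obtain ⟨u₀, hu₀, hu₀j⟩ : ∃ u ∈ W, u j = 1 :=
    ⟨(u' j)⁻¹ • u', W.smul_mem _ hu', inv_mul_cancel₀ hu'j⟩
  set U := vanishing W (insert j ∅)
  have hUj : ∀ w ∈ U, w j = 0 := fun w hw => hw.2 j (by simp)
  obtain ⟨B, u, -, hB, huU, hdual, hgen⟩ := exists_dual_vectors U ∅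
  rw [Finset.coe_empty, eRank_delete_empty] at hB
  let w : E → MvPolynomial B K := fun i =>
    MvPolynomial.C (u₀ i) + ∑ b : B, MvPolynomial.X b * MvPolynomial.C (u b i)
  have hwB : ∀ b : B, w b = MvPolynomial.C (u₀ b) + MvPolynomial.X b := by
    intro b
    simp only [w]
    congr 1
    have : ∀ b' : B, (MvPolynomial.X b' * MvPolynomial.C (u b' b) : MvPolynomial B K) =
        if b' = b then MvPolynomial.X b' else 0 := fun b' => by
      rw [hdual b' b'.2 b b.2]
      by_cases h : b' = b <;> simp [h]
    simp [this]
  refine ⟨B, inferInstance, w, ?_, ?_, ?_, ?_, ?_⟩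
  · rw [Fintype.card_coe, hB, hfin]
  · simp only [w, hu₀j]
    simp [fun b : B => hUj _ (huU b b.2)]
  · refine LiesIn.add (liesIn_algebraMap hu₀) (LiesIn.sum _ fun b _ => ?_)
    exact (liesIn_algebraMap (huU b b.2).1).mul_left _
  · rw [← AlgHom.range_eq_top, ← top_le_iff, ← MvPolynomial.adjoin_range_X, Algebra.adjoin_le_iff]
    rintro _ ⟨b, rfl⟩
    refine ⟨MvPolynomial.X (b : E) - MvPolynomial.C (u₀ b), ?_⟩
    simp [hwB]
  · intro A _ _ v hv hvj
    refine ⟨MvPolynomial.aeval fun b : B => v b - algebraMap K A (u₀ b), fun i => ?_⟩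
    have h1 : LiesIn U (fun i => v i - algebraMap K A (u₀ i)) :=
      (hv.sub (liesIn_algebraMap hu₀)).vanishing_of_forall (insert j ∅) (by simp [hvj, hu₀j])
    have h2 := LiesIn.eq_sum h1 B (fun b => u b i) i (fun x hx => hgen x hx i (by simp))
    have h3 : v i = algebraMap K A (u₀ i) + (v i - algebraMap K A (u₀ i)) := by ring
    rw [h3, h2, ← Finset.sum_coe_sort B]
    simp [w]

end Configuration

/-! ### Complements of hyperplane arrangements -/

namespace Configuration

variable {E K : Type} [Fintype E] [Field K] (W : Submodule K (E → K))

section affine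

variable {R : Type} [CommRing R] [Algebra K R]

/-- The morphism `Spec R → 𝔸^E` with coordinates `w`. -/
def affinePoint (w : E → R) : Spec (.of R) ⟶ Spec (.of (MvPolynomial E K)) :=
  Spec.map (CommRingCat.ofHom (MvPolynomial.aeval w : MvPolynomial E K →ₐ[K] R).toRingHom)

omit [Fintype E] in
theorem affinePoint_comp (w : E → R) :
    affinePoint (K := K) w ≫ Spec.map (CommRingCat.ofHom (algebraMap K (MvPolynomial E K))) =
      Spec.map (CommRingCat.ofHom (algebraMap K R)) := by
  rw [affinePoint, ← Spec.map_comp, ← CommRingCat.ofHom_comp]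
  congr 2
  exact (MvPolynomial.aeval w : MvPolynomial E K →ₐ[K] R).comp_algebraMap

variable (K) in
/-- The locus in `𝔸^E` where the `i`-th coordinate is nonzero. -/
def coordOpen (i : E) : (Spec (.of (MvPolynomial E K))).Opens :=
  PrimeSpectrum.basicOpen (MvPolynomial.X i)

omit [Fintype E] in
theorem affinePoint_mem_coordOpen (w : E → R) (y : Spec (.of R)) (i : E) :
    affinePoint (K := K) w y ∈ coordOpen K i ↔ w i ∉ y.asIdeal := by
  change MvPolynomial.aeval (R := K) w (MvPolynomial.X i) ∉ y.asIdeal ↔ _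
  rw [MvPolynomial.aeval_X]

/-- The points of the affine slice `{w ∈ W | w_j = 1}` in `𝔸^E`. -/
def sliceSet (j : E) : Set (Spec (.of (MvPolynomial E K))) :=
  PrimeSpectrum.zeroLocus ({p | ∃ φ : E → K, (∀ w ∈ W, ∑ i, φ i * w i = 0) ∧
    p = ∑ i, MvPolynomial.C (φ i) * MvPolynomial.X i} ∪ {MvPolynomial.X j - 1})

theorem isLocallyClosed_sliceSet (j : E) : IsLocallyClosed (sliceSet W j) :=
  (PrimeSpectrum.isClosed_zeroLocus _).isLocallyClosed

variable {W}

theorem affinePoint_mem_sliceSet {w : E → R} (h : LiesIn W w) {j : E} (hj : w j = 1)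
    (y : Spec (.of R)) : affinePoint (K := K) w y ∈ sliceSet W j := by
  change (_ : Set (MvPolynomial E K)) ⊆ _
  rintro _ (⟨φ, hφ, rfl⟩ | rfl)
  · change MvPolynomial.aeval (R := K) w _ ∈ y.asIdeal
    have := h φ hφ
    simp [this]
  · change MvPolynomial.aeval (R := K) w _ ∈ y.asIdeal
    simp [hj]

/-- Every point of the affine slice comes from a vector over a field. -/
theorem exists_affinePoint_eq {j : E} {x : Spec (.of (MvPolynomial E K))} (hx : x ∈ sliceSet W j) :
    ∃ (κ : Type) (_ : Field κ) (_ : Algebra K κ) (v : E → κ) (y : Spec (.of κ)),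
      LiesIn W v ∧ v j = 1 ∧ affinePoint (K := K) v y = x := by
  let x' : PrimeSpectrum (MvPolynomial E K) := x
  obtain ⟨y, hy⟩ := exists_SpecMap_residueField_eq x'
  let φ : MvPolynomial E K →ₐ[K] x'.asIdeal.ResidueField := IsScalarTower.toAlgHom _ _ _
  have hφ : MvPolynomial.aeval (fun i => φ (MvPolynomial.X i)) = φ := by
    refine MvPolynomial.algHom_ext fun i => ?_
    simp
  have h0 : ∀ p ∈ x'.asIdeal, φ p = 0 := fun p hp => by
    rw [← Ideal.ker_algebraMap_residueField x'.asIdeal] at hp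
    exact hp
  refine ⟨x'.asIdeal.ResidueField, inferInstance, inferInstance, fun i => φ (MvPolynomial.X i), y,
    fun ψ hψ => ?_, ?_, ?_⟩
  · simpa using h0 _ (hx (Or.inl ⟨ψ, hψ, rfl⟩))
  · simpa [sub_eq_zero] using h0 _ (hx (Or.inr rfl))
  · rw [affinePoint, hφ]
    exact hy

omit [Fintype E] in
theorem affinePoint_mem_range {B : Type} [CommRing B] [Algebra K B] {w : E → R} {v : E → B}
    (φ : R →ₐ[K] B) (hφ : ∀ i, φ (w i) = v i) (y : Spec (.of B)) :
    affinePoint (K := K) v y ∈ Set.range (affinePoint (K := K) w) := by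
  refine ⟨Spec.map (CommRingCat.ofHom φ.toRingHom) y, ?_⟩
  have : affinePoint (K := K) v = Spec.map (CommRingCat.ofHom φ.toRingHom) ≫ affinePoint w := by
    rw [affinePoint, affinePoint, ← Spec.map_comp, ← CommRingCat.ofHom_comp]
    congr 2
    have : MvPolynomial.aeval (R := K) v = φ.comp (MvPolynomial.aeval w) :=
      MvPolynomial.algHom_ext fun i => by simp [hφ]
    rw [this]
    rfl
  rw [this]
  rfl

omit [Fintype E] in
theorem notMem_asIdeal_of_field {κ : Type} [Field κ] (y : Spec (.of κ)) {c : κ} :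
    c ∉ y.asIdeal ↔ c ≠ 0 := by
  refine ⟨fun h h0 => h (h0 ▸ zero_mem _), fun h hc => ?_⟩
  exact y.isPrime.ne_top (Ideal.eq_top_of_isUnit_mem _ hc h.isUnit)

variable (W)

open GrothendieckRing

/-- The class of the affine space `{w ∈ W | w_A = 0, w_j = 1}`. -/
theorem setClass_sliceSet (s : Finset E) (j : E) :
    setClass (Spec.map (CommRingCat.ofHom (algebraMap K (MvPolynomial E K))))
      {x ∈ sliceSet W j | ∀ i ∈ s, x ∉ coordOpen K i} =
    Polynomial.aeval (lefschetz K) (slicePoly W s j) := by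
  have hf := isVariety_Spec K (MvPolynomial E K)
  rw [slicePoly]
  split_ifs with h
  · obtain ⟨σ, _, w, hcard, hwj, hw, hsurj, hlift⟩ := exists_slice_parametrization h
    have hwW : LiesIn W w := hw.mono fun x hx => (mem_vanishing.1 hx).1
    have hws : ∀ i ∈ s, w i = 0 := fun i hi => by
      have := LiesIn.eq_sum hw ∅ 0 i (fun x hx => by simpa using hx.2 i hi)
      simpa using this
    have hrange : Set.range (affinePoint (K := K) w) =
        {x ∈ sliceSet W j | ∀ i ∈ s, x ∉ coordOpen K i} := by
      apply Set.Subset.antisymm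
      · rintro _ ⟨y, rfl⟩
        refine ⟨affinePoint_mem_sliceSet hwW hwj y, fun i hi => ?_⟩
        rw [affinePoint_mem_coordOpen, hws i hi]
        exact fun h => h (zero_mem _)
      · rintro x ⟨hx, hxs⟩
        obtain ⟨κ, _, _, v, y, hv, hvj, rfl⟩ := exists_affinePoint_eq hx
        obtain ⟨φ, hφ⟩ := hlift κ v (hv.vanishing_of_forall s fun i hi => by
          have := hxs i hi
          rwa [affinePoint_mem_coordOpen, notMem_asIdeal_of_field, not_not] at this) hvj
        exact affinePoint_mem_range φ hφ y
    have : IsClosedImmersion (affinePoint (K := K) w) :=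
      IsClosedImmersion.spec_of_surjective _ hsurj
    rw [← hrange, setClass_range hf, affinePoint_comp]
    change affineClass K (MvPolynomial σ K) = _
    rw [affineClass_mvPolynomial, affineClass_self, one_mul, map_pow, Polynomial.aeval_X, ← hcard,
      Nat.add_sub_cancel]
  · push Not at h
    rw [map_zero, ← setClass_empty hf]
    congr 1
    refine Set.eq_empty_of_forall_notMem ?_
    rintro x ⟨hx, hxs⟩
    obtain ⟨κ, _, _, v, y, hv, hvj, rfl⟩ := exists_affinePoint_eq hx
    have h1 := LiesIn.eq_sum (hv.vanishing_of_forall s fun i hi => by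
      have := hxs i hi
      rwa [affinePoint_mem_coordOpen, notMem_asIdeal_of_field, not_not] at this) ∅ 0 j
        (fun x hx => by simpa using h x hx)
    simp [hvj] at h1

/-- The affine complement of the hyperplane arrangement of `M / F`: the universal vector `w` of
`W` over a `K`-algebra with `w_j = 1`, `w_i = 0` for `i ∈ F` and `w_i` invertible for `i ∉ F`. Its
class is the reduced characteristic polynomial of `M / F` at `𝕃`. -/
theorem exists_arrangement_complement [DecidableEq E] {F : Finset E} {j : E} (hj : j ∉ F)
    (hjF : ∃ u ∈ vanishing W F, u j ≠ 0) :
    ∃ (R : Type) (_ : CommRing R) (_ : Algebra K R) (w : E → R),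
      Algebra.FiniteType K R ∧
      affineClass K R = Polynomial.aeval (lefschetz K)
        ((matroid W).contract (F : Set E)).reducedCharPoly ∧
      w j = 1 ∧ LiesIn W w ∧ (∀ i ∈ F, w i = 0) ∧ (∀ i ∉ F, IsUnit (w i)) ∧
      (∀ a, ∃ p n, MvPolynomial.aeval (R := K) w p =
        MvPolynomial.aeval w (∏ i ∈ Fᶜ, MvPolynomial.X (R := K) i) ^ n * a) ∧
      ∀ (κ : Type) [Field κ] [Algebra K κ] (v : E → κ), LiesIn W v → v j = 1 →
        (∀ i, v i ≠ 0 ↔ i ∉ F) → ∃ φ : R →ₐ[K] κ, ∀ i, φ (w i) = v i := by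
  obtain ⟨σ, _, w, hcard, hwj, hw, hsurj, hlift⟩ := exists_slice_parametrization hjF
  have hwF : ∀ i ∈ F, w i = 0 := fun i hi => by
    have := LiesIn.eq_sum hw ∅ 0 i (fun x hx => by simpa using hx.2 i hi)
    simpa using this
  let g : MvPolynomial σ K := ∏ i ∈ Fᶜ, w i
  let R := Localization.Away g
  let ι : MvPolynomial σ K →ₐ[K] R := IsScalarTower.toAlgHom _ _ _
  have hg : IsUnit (ι g) := IsLocalization.Away.algebraMap_isUnit g
  have hft : Algebra.FiniteType K R := inferInstanceAs (Algebra.FiniteType K (Localization.Away g))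
  have hcomp : ∀ p, MvPolynomial.aeval (R := K) (fun i => ι (w i)) p =
      ι (MvPolynomial.aeval w p) := fun p => by
    rw [← AlgHom.comp_apply]
    congr 1
    exact MvPolynomial.algHom_ext fun i => by simp
  have hprod : MvPolynomial.aeval (fun i => ι (w i)) (∏ i ∈ Fᶜ, MvPolynomial.X (R := K) i) =
      ι g := by
    rw [hcomp]
    simp [g]
  have hunit : ∀ i ∉ F, IsUnit (ι (w i)) := fun i hi =>
    isUnit_of_dvd_unit (map_dvd ι (Finset.dvd_prod_of_mem w (by simpa using hi))) hg
  have hgen : ∀ a, ∃ p n, MvPolynomial.aeval (R := K) (fun i => ι (w i)) p =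
      MvPolynomial.aeval (fun i => ι (w i)) (∏ i ∈ Fᶜ, MvPolynomial.X (R := K) i) ^ n * a := by
    intro a
    obtain ⟨n, q, hq⟩ := IsLocalization.Away.surj g a
    obtain ⟨p, hp⟩ := hsurj q
    refine ⟨p, n, ?_⟩
    rw [hcomp, hp, hprod, mul_comm]
    exact hq.symm
  have hLies : LiesIn W (fun i => ι (w i)) := (hw.mono fun x hx => (mem_vanishing.1 hx).1).map ι
  have hpoint : ∀ (κ : Type) [Field κ] [Algebra K κ] (v : E → κ), LiesIn W v → v j = 1 →
        (∀ i, v i ≠ 0 ↔ i ∉ F) → ∃ φ : R →ₐ[K] κ, ∀ i, φ (ι (w i)) = v i := by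
    intro κ _ _ v hv hvj hvF
    obtain ⟨φ, hφ⟩ := hlift κ v (hv.vanishing_of_forall F fun i hi => by
      have := (hvF i).not
      tauto) hvj
    have hφg : IsUnit (φ g) := by
      rw [map_prod, isUnit_iff_ne_zero, Finset.prod_ne_zero_iff]
      intro i hi
      rw [hφ, hvF]
      simpa using hi
    refine ⟨IsLocalization.liftAlgHom (M := Submonoid.powers g) (f := φ)
      (by rintro ⟨_, n, rfl⟩; simpa using hφg.pow n), fun i => ?_⟩
    rw [← hφ]
    simp [ι, IsLocalization.liftAlgHom_apply]
  refine ⟨R, inferInstance, inferInstance, fun i => ι (w i), hft, ?_, by simp [hwj], hLies,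
    fun i hi => by simp [hwF i hi], hunit, hgen, hpoint⟩
  have hf := isVariety_Spec K (MvPolynomial E K)
  have : IsImmersion (affinePoint (K := K) fun i => ι (w i)) :=
    isImmersion_SpecMap_of_forall_exists _ _ (by
      change IsUnit (MvPolynomial.aeval (fun i => ι (w i)) (∏ i ∈ Fᶜ, MvPolynomial.X (R := K) i))
      rwa [hprod]) hgen
  have hrange : Set.range (affinePoint (K := K) fun i => ι (w i)) =
      {x ∈ {x ∈ sliceSet W j | ∀ i ∈ F, x ∉ coordOpen K i} | ∀ i ∈ Fᶜ, x ∈ coordOpen K i} := by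
    apply Set.Subset.antisymm
    · rintro _ ⟨y, rfl⟩
      refine ⟨⟨affinePoint_mem_sliceSet hLies (by simp [hwj]) y, fun i hi => ?_⟩, fun i hi => ?_⟩
      · rw [affinePoint_mem_coordOpen, hwF i hi, map_zero]
        exact fun h => h (zero_mem _)
      · rw [affinePoint_mem_coordOpen]
        exact fun h => y.isPrime.ne_top
          (Ideal.eq_top_of_isUnit_mem _ h (hunit i (by simpa using hi)))
    · rintro x ⟨⟨hx, hxF⟩, hxF'⟩
      obtain ⟨κ, _, _, v, y, hv, hvj, rfl⟩ := exists_affinePoint_eq hx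
      simp only [affinePoint_mem_coordOpen] at hxF hxF'
      obtain ⟨φ, hφ⟩ := hpoint κ v hv hvj fun i =>
        ⟨fun h hi => hxF i hi ((notMem_asIdeal_of_field y).2 h),
          fun hi => (notMem_asIdeal_of_field y).1 (hxF' i (by simpa using hi))⟩
      exact affinePoint_mem_range φ hφ y
  have hcls : affineClass K R =
      setClass (Spec.map (CommRingCat.ofHom (algebraMap K (MvPolynomial E K))))
        (Set.range (affinePoint (K := K) fun i => ι (w i))) := by
    rw [affineClass, ← affinePoint_comp (K := K) (fun i => ι (w i)), ← setClass_range hf]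
  rw [hcls, hrange, setClass_forall_mem_eq_sum hf _ _
    (isLocallyClosed_inter_forall_notMem _ (isLocallyClosed_sliceSet W j) F),
    reducedCharPoly_contract_eq_sum W hj, map_sum]
  refine Finset.sum_congr rfl fun A _ => ?_
  have h1 : {x ∈ {x ∈ sliceSet W j | ∀ i ∈ F, x ∉ coordOpen K i} | ∀ i ∈ A, x ∉ coordOpen K i} =
      {x ∈ sliceSet W j | ∀ i ∈ F ∪ A, x ∉ coordOpen K i} := by
    ext x
    simp only [Set.mem_ofPred_eq, Finset.forall_mem_union, and_assoc]
  rw [h1, setClass_sliceSet, map_mul, map_pow, map_neg, map_one]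

end affine

end Configuration

/-! ### The stratification by flats -/

namespace Configuration

attribute [local instance] MvPolynomial.gradedAlgebra

open GrothendieckRing

variable {E K : Type} [Fintype E] [Field K] (W : Submodule K (E → K))

/-- The closure of `F` consists of the coordinates that vanish on `{w ∈ W | w_F = 0}`. -/
theorem mem_closure_matroid_iff_forall_vanishing [DecidableEq E] (F : Finset E) (e : E) :
    e ∈ (matroid W).closure F ↔ ∀ w ∈ vanishing W F, w e = 0 := by
  rw [mem_closure_matroid_iff]
  constructor
  · intro h w hw
    have hle : Submodule.span K (coordFn W '' (F : Set E)) ≤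
        LinearMap.ker (Module.Dual.eval K W ⟨w, hw.1⟩) := by
      rw [Submodule.span_le]
      rintro _ ⟨i, hi, rfl⟩
      exact hw.2 i hi
    exact hle h
  · intro h
    have h1 := finrank_vanishing W F
    have h2 := finrank_vanishing W (insert e F)
    rw [vanishing_insert_of_forall W h, ← h1, add_left_inj] at h2
    have h3 := Submodule.eq_of_le_of_finrank_eq (Submodule.span_mono
      (Set.image_mono (Finset.coe_subset.2 (Finset.subset_insert e F)))) h2.symm
    rw [h3]
    exact Submodule.subset_span ⟨e, by simp, rfl⟩

/-- The part of the incidence set where precisely the coordinates `w_i`, `i ∈ F`, vanish. -/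
def stratum (F : Finset E) : Set (biproj E K) :=
  {x ∈ incidenceSet W | ∀ i ∈ Finset.univ, x ∈ firstOpen K i ↔ i ∉ F}

theorem isLocallyClosed_stratum (F : Finset E) : IsLocallyClosed (stratum W F) := by
  classical
  have h : stratum W F = {x ∈ incidenceSet W | ∀ i ∈ F, x ∉ firstOpen K i} ∩
      ⋂ i ∈ Fᶜ, (firstOpen K i : Set (biproj E K)) := by
    ext x
    simp only [stratum, Set.mem_ofPred_eq, Finset.mem_univ, true_imp_iff, Set.mem_inter_iff,
      Set.mem_iInter, Finset.mem_compl, SetLike.mem_coe, and_assoc]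
    refine and_congr_right fun _ => ⟨fun h => ⟨fun i hi hx => (h i).1 hx hi, fun i => (h i).2⟩,
      fun h i => ⟨fun hx hi => h.1 i hi hx, h.2 i⟩⟩
  rw [h]
  exact (isLocallyClosed_inter_forall_notMem _ isClosed_incidenceSet.isLocallyClosed F).inter
    (isOpen_biInter_finset fun i _ => (firstOpen K i).isOpen).isLocallyClosed

variable {W} {F : Finset E}

/-- Points of a stratum come from pairs of normalized vectors over a field, the first of which has
vanishing locus `F`. -/
theorem exists_field_point_of_mem_stratum {x : biproj E K} (hx : x ∈ stratum W F) {j k : E}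
    (hj : j ∉ F) (hk : x ∈ secondOpen K k) :
    ∃ (κ : Type) (_ : Field κ) (_ : Algebra K κ) (v b : E → κ) (hv : v j = 1) (hb : b k = 1)
      (y : Spec (.of κ)), IsIncident W v b ∧ (∀ i, v i ≠ 0 ↔ i ∉ F) ∧
      pairPoint (K := K) v b ⟨j, hv ▸ isUnit_one⟩ ⟨k, hb ▸ isUnit_one⟩ y = x := by
  obtain ⟨κ, _, _, v, b, hv, hb, y, h, rfl⟩ :=
    exists_field_point hx.1 ((hx.2 j (Finset.mem_univ j)).2 hj) hk
  refine ⟨κ, _, _, v, b, hv, hb, y, h, fun i => ?_, rfl⟩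
  rw [← hx.2 i (Finset.mem_univ i), pairPoint_mem_firstOpen, notMem_asIdeal_of_field]

/-- Only the strata of proper flats are nonempty. -/
theorem isFlat_of_mem_stratum {x : biproj E K} (hx : x ∈ stratum W F) :
    (matroid W).IsFlat F ∧ (F : Set E) ≠ Set.univ := by
  classical
  obtain ⟨j, hj⟩ := exists_mem_firstOpen x
  rw [hx.2 j (Finset.mem_univ j)] at hj
  obtain ⟨k, hk⟩ := exists_mem_secondOpen x
  obtain ⟨κ, _, _, v, b, hv, hb, y, h, hvF, -⟩ := exists_field_point_of_mem_stratum hx hj hk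
  refine ⟨?_, fun h => hj (Finset.mem_coe.1 (h ▸ Set.mem_univ j))⟩
  rw [Matroid.isFlat_iff_closure_eq]
  refine Set.Subset.antisymm (fun e he => ?_)
    ((matroid W).subset_closure (F : Set E) (Set.subset_univ _))
  rw [mem_closure_matroid_iff_forall_vanishing] at he
  have h1 := LiesIn.eq_sum (h.liesIn.vanishing_of_forall F fun i hi => by
      have := (hvF i).not
      tauto) ∅ 0 e (fun w hw => by simpa using he w hw)
  rw [Finset.sum_empty] at h1
  by_contra hn
  exact (hvF e).2 hn h1

/-- If `v` vanishes on `F`, the equations on `b` can be solved for the coordinates in a basis `B`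
of `M \ F`. -/
theorem isIncident_iff_of_dual_vectors [DecidableEq E] {A : Type} [CommRing A] [Algebra K A]
    {B : Finset E} {u : E → E → K}
    (hu : ∀ c ∈ B, u c ∈ W) (hdual : ∀ c ∈ B, ∀ c' ∈ B, u c c' = if c = c' then 1 else 0)
    (hgen : ∀ w ∈ W, ∀ i ∉ F, w i = ∑ c ∈ B, w c * u c i) {v : E → A} (hv : LiesIn W v)
    (hvF : ∀ i ∈ F, v i = 0) (b : E → A) :
    IsIncident W v b ↔
      ∀ c ∈ B, v c * b c + ∑ i ∈ Bᶜ, algebraMap K A (u c i) * (v i * b i) = 0 := by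
  have hsplit : ∀ c ∈ B, ∑ i, algebraMap K A (u c i) * (v i * b i) =
      v c * b c + ∑ i ∈ Bᶜ, algebraMap K A (u c i) * (v i * b i) := by
    intro c hc
    rw [← Finset.sum_add_sum_compl B]
    congr 1
    rw [Finset.sum_eq_single_of_mem c hc, hdual c hc c hc, if_pos rfl, map_one, one_mul]
    intro i hi hne
    rw [hdual c hc i hi, if_neg hne.symm, map_zero, zero_mul]
  constructor
  · intro h c hc
    rw [← hsplit c hc]
    exact h.orthogonal _ (hu c hc)
  · intro h
    refine ⟨hv, fun w hw => ?_⟩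
    have h1 : ∀ i, algebraMap K A (w i) * (v i * b i) =
        ∑ c ∈ B, algebraMap K A (w c) * (algebraMap K A (u c i) * (v i * b i)) := by
      intro i
      by_cases hi : i ∈ F
      · simp [hvF i hi]
      · rw [hgen w hw i hi, map_sum, Finset.sum_mul]
        refine Finset.sum_congr rfl fun c _ => ?_
        rw [map_mul, mul_assoc]
    rw [Finset.sum_congr rfl fun i _ => h1 i, Finset.sum_comm]
    refine Finset.sum_eq_zero fun c hc => ?_
    rw [← Finset.mul_sum, hsplit c hc, h c hc, mul_zero]

section leaf

variable [DecidableEq E] {R : Type} [CommRing R] [Algebra K R] (w w' : E → R) (B : Finset E)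
  (u : E → E → K) {m : ℕ} (e : Fin m ≃ (Bᶜ : Finset E)) (t : Fin m)

/-- The free coordinates of `β`, numbered by `Fin m`, in the part where the first nonzero one is the
`t`-th one and is normalized to `1`. -/
def freeCoord (s : Fin m) : MvPolynomial {s : Fin m // t < s} R :=
  if h : t < s then MvPolynomial.X ⟨s, h⟩ else if s = t then 1 else 0

theorem freeCoord_self : freeCoord (R := R) t t = 1 := by simp [freeCoord]

theorem freeCoord_of_lt {s : Fin m} (h : s < t) : freeCoord (R := R) t s = 0 := by
  simp [freeCoord, h.not_gt, h.ne]

theorem freeCoord_val (s : {s : Fin m // t < s}) : freeCoord (R := R) t s = MvPolynomial.X s := by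
  simp [freeCoord, s.2]

/-- The solution `β` of the incidence equations with prescribed coordinates outside `B`, over a
vector `w` that has inverses `w'` of its coordinates in `B`. -/
def solution (i : E) : MvPolynomial {s : Fin m // t < s} R :=
  if h : i ∈ Bᶜ then freeCoord t (e.symm ⟨i, h⟩) else
    -MvPolynomial.C (w' i) * ∑ s, algebraMap K _ (u i (e s)) *
      (MvPolynomial.C (w (e s)) * freeCoord t s)

theorem solution_apply (s : Fin m) : solution w w' B u e t (e s) = freeCoord t s := by
  rw [solution, dif_pos (e s).2]
  simp

theorem sum_compl_eq_sum {A : Type*} [AddCommMonoid A] (f : E → A) :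
    ∑ i ∈ Bᶜ, f i = ∑ s, f (e s) := by
  rw [← Finset.sum_coe_sort Bᶜ, ← e.sum_comp]

theorem C_mul_solution {c : E} (hc : c ∈ B) (hw : w c * w' c = 1) :
    MvPolynomial.C (w c) * solution w w' B u e t c + ∑ i ∈ Bᶜ, algebraMap K _ (u c i) *
      (MvPolynomial.C (w i) * solution w w' B u e t i) = 0 := by
  rw [sum_compl_eq_sum B e]
  simp only [solution_apply]
  rw [solution, dif_neg (by simpa using hc), ← mul_assoc, mul_neg, ← MvPolynomial.C_mul, hw]
  simp

end leaf

/-- The part of the stratum of `F` where `e t` is the first nonzero one among the coordinates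
of `β` outside `B` is a product of the arrangement complement with an affine space. -/
theorem setClass_stratum_first [DecidableEq E] {R : Type} [CommRing R] [Algebra K R]
    [Algebra.FiniteType K R] {w : E → R} {j : E} (hj : j ∉ F) (hwj : w j = 1) (hw : LiesIn W w)
    (hwF : ∀ i ∈ F, w i = 0) (hwu : ∀ i ∉ F, IsUnit (w i))
    (hwgen : ∀ a, ∃ p n, MvPolynomial.aeval (R := K) w p =
      MvPolynomial.aeval w (∏ i ∈ Fᶜ, MvPolynomial.X (R := K) i) ^ n * a)
    (huniv : ∀ (κ : Type) [Field κ] [Algebra K κ] (v : E → κ), LiesIn W v → v j = 1 →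
      (∀ i, v i ≠ 0 ↔ i ∉ F) → ∃ φ : R →ₐ[K] κ, ∀ i, φ (w i) = v i)
    {B : Finset E} {u : E → E → K} (hBF : Disjoint B F)
    (hu : ∀ c ∈ B, u c ∈ W) (hdual : ∀ c ∈ B, ∀ c' ∈ B, u c c' = if c = c' then 1 else 0)
    (hgen : ∀ w ∈ W, ∀ i ∉ F, w i = ∑ c ∈ B, w c * u c i) {m : ℕ}
    (e : Fin m ≃ (Bᶜ : Finset E)) (t : Fin m) :
    setClass (biprojOver E K) {x ∈ stratum W F | x ∈ secondOpen K (e t : E) ∧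
      ∀ s < t, x ∉ secondOpen K (e s : E)} =
    affineClass K R * lefschetz K ^ (m - 1 - t) := by
  have hBF' : ∀ c ∈ B, c ∉ F := fun c hc => Finset.disjoint_left.1 hBF hc
  choose! w' hw' using fun i hi => (hwu i hi).exists_right_inv
  let A := MvPolynomial {s : Fin m // t < s} R
  let ι : R →ₐ[K] A := IsScalarTower.toAlgHom K R A
  let v : E → A := fun i => ι (w i)
  let b : E → A := solution w w' B u e t
  have hv : v j = 1 := by simp [v, hwj]
  have hb : b (e t) = 1 := by rw [← freeCoord_self (R := R) t, ← solution_apply w w' B u e t t]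
  have hvW : LiesIn W v := hw.map ι
  have hvF : ∀ i ∈ F, v i = 0 := fun i hi => by simp [v, hwF i hi]
  have hinc : IsIncident W v b := (isIncident_iff_of_dual_vectors hu hdual hgen hvW hvF b).2
    fun c hc => C_mul_solution w w' B u e t hc (hw' c (hBF' c hc))
  have haeval : ∀ p, MvPolynomial.aeval (R := K) (Sum.elim v b) (MvPolynomial.rename Sum.inl p) =
      ι (MvPolynomial.aeval w p) := fun p => by
    rw [MvPolynomial.aeval_rename, Sum.elim_comp_inl, ← AlgHom.comp_apply]
    congr 1
    exact MvPolynomial.algHom_ext fun i => by simp [v]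
  have himm : IsImmersion (pairPoint (K := K) v b ⟨j, hv ▸ isUnit_one⟩ ⟨_, hb ▸ isUnit_one⟩) := by
    refine isImmersion_pairPoint v b hv hb
      (MvPolynomial.rename Sum.inl (∏ i ∈ Fᶜ, MvPolynomial.X (R := K) i)) ?_ ?_
    · rw [haeval]
      refine IsUnit.map ι ?_
      rw [map_prod, IsUnit.prod_iff]
      intro i hi
      rw [MvPolynomial.aeval_X]
      exact hwu i (by simpa using hi)
    -- the polynomial variables are coordinates of `β`, and the coefficients are generated by `w`
    · intro a
      simp only [haeval]
      induction a using MvPolynomial.induction_on with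
      | C r =>
        obtain ⟨p, n, h⟩ := hwgen r
        refine ⟨MvPolynomial.rename Sum.inl p, n, ?_⟩
        rw [haeval, h, map_mul, map_pow]
        rfl
      | add a a' ha ha' =>
        obtain ⟨p, n, h⟩ := ha
        obtain ⟨p', n', h'⟩ := ha'
        refine ⟨MvPolynomial.rename Sum.inl (∏ i ∈ Fᶜ, MvPolynomial.X (R := K) i) ^ n' * p +
          MvPolynomial.rename Sum.inl (∏ i ∈ Fᶜ, MvPolynomial.X (R := K) i) ^ n * p', n + n', ?_⟩
        rw [map_add, map_mul, map_mul, map_pow, map_pow, haeval, h, h']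
        ring
      | mul_X a s ha =>
        obtain ⟨p, n, h⟩ := ha
        refine ⟨p * MvPolynomial.X (Sum.inr (e s : E)), n, ?_⟩
        rw [map_mul, h, MvPolynomial.aeval_X, mul_assoc]
        congr 2
        exact (solution_apply w w' B u e t s).trans (freeCoord_val t s)
  have hrange : Set.range (pairPoint (K := K) v b ⟨j, hv ▸ isUnit_one⟩ ⟨_, hb ▸ isUnit_one⟩) =
      {x ∈ stratum W F | x ∈ secondOpen K (e t : E) ∧ ∀ s < t, x ∉ secondOpen K (e s : E)} := by
    apply Set.Subset.antisymm
    · rintro _ ⟨y, rfl⟩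
      have hunit : ∀ z : A, IsUnit z → z ∉ y.asIdeal := fun z hz h =>
        y.isPrime.ne_top (Ideal.eq_top_of_isUnit_mem _ h hz)
      refine ⟨⟨range_pairPoint_subset hinc _ _ ⟨y, rfl⟩, fun i _ => ?_⟩, ?_, fun s hs => ?_⟩
      · rw [pairPoint_mem_firstOpen]
        refine ⟨fun h hi => h (hvF i hi ▸ zero_mem _), fun hi => hunit _ ((hwu i hi).map ι)⟩
      · rw [pairPoint_mem_secondOpen, hb]
        exact hunit _ isUnit_one
      · rw [pairPoint_mem_secondOpen, not_not]
        have : b (e s) = 0 := (solution_apply w w' B u e t s).trans (freeCoord_of_lt t hs)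
        rw [this]
        exact zero_mem _
    · rintro x ⟨hx, hxt, hxs⟩
      obtain ⟨κ, _, _, v₁, b₁, hv₁, hb₁, y, hinc₁, hvF₁, rfl⟩ :=
        exists_field_point_of_mem_stratum hx hj hxt
      obtain ⟨φ, hφ⟩ := huniv κ v₁ hinc₁.liesIn hv₁ hvF₁
      -- a field point of the piece specializes the universal one, its coordinates in `B` being
      -- determined by the other ones
      let Φ : A →ₐ[K] κ := MvPolynomial.aevalTower φ fun s => b₁ (e s)
      have hΦC : ∀ r, Φ (MvPolynomial.C r) = φ r := fun r => MvPolynomial.aevalTower_C _ _ _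
      have hΦv : ∀ i, Φ (v i) = v₁ i := fun i => (hΦC _).trans (hφ i)
      have hΦfree : ∀ s, Φ (b (e s)) = b₁ (e s) := by
        intro s
        rw [show b (e s) = _ from solution_apply w w' B u e t s]
        rcases lt_trichotomy s t with h | rfl | h
        · rw [freeCoord_of_lt t h, map_zero]
          have := hxs s h
          rw [pairPoint_mem_secondOpen, notMem_asIdeal_of_field, not_not] at this
          exact this.symm
        · rw [freeCoord_self, map_one, hb₁]
        · rw [freeCoord_val t ⟨s, h⟩]
          exact MvPolynomial.aevalTower_X _ _ _
      have hvF₁' : ∀ i ∈ F, v₁ i = 0 := fun i hi => by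
        have := (hvF₁ i).not
        tauto
      have hΦinc : IsIncident W v₁ fun i => Φ (b i) := by
        have := hinc.map Φ
        simp only [hΦv] at this
        exact this
      have hv₁W := hinc₁.liesIn
      rw [isIncident_iff_of_dual_vectors hu hdual hgen hv₁W hvF₁'] at hinc₁ hΦinc
      refine pairPoint_mem_range Φ hΦv (fun i => ?_) _ _ _ _ y
      by_cases hi : i ∈ B
      · have h1 := hinc₁ i hi
        have h2 := hΦinc i hi
        rw [sum_compl_eq_sum B e] at h1 h2
        simp only [hΦfree] at h2
        exact mul_left_cancel₀ ((hvF₁ i).2 (hBF' i hi)) (add_right_cancel (h2.trans h1.symm))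
      · obtain ⟨s, hs⟩ := e.surjective ⟨i, by simpa using hi⟩
        have := hΦfree s
        rwa [hs] at this
  rw [← hrange, setClass_range isVariety_biprojOver, pairPoint_biprojOver]
  change affineClass K A = _
  rw [affineClass_mvPolynomial]
  congr 2
  rw [Fintype.card_subtype, Finset.filter_lt_eq_Ioi, Fin.card_Ioi]

/-- The class of the stratum of a proper flat `F`: over the arrangement complement of `M / F` the
fibres are projective spaces of dimension `|E| - rk (M \ F) - 1`. -/
theorem setClass_stratum (hF : (matroid W).IsFlat F) (hF' : (F : Set E) ≠ Set.univ) :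
    setClass (biprojOver E K) (stratum W F) =
      Polynomial.aeval (lefschetz K) ((matroid W).contract (F : Set E)).reducedCharPoly *
        ∑ i ∈ Finset.range (Fintype.card E - ((matroid W).delete (F : Set E)).eRank.toNat),
          lefschetz K ^ i := by
  classical
  obtain ⟨j, hj⟩ := (Set.ne_univ_iff_exists_notMem _).1 hF'
  have hj' : ∃ w ∈ vanishing W F, w j ≠ 0 := by
    rw [← hF.closure, mem_closure_matroid_iff_forall_vanishing] at hj
    push Not at hj
    exact hj
  obtain ⟨R, _, _, w, _, hR, hwj, hw, hwF, hwu, hwgen, huniv⟩ :=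
    exists_arrangement_complement W (Finset.mem_coe.not.1 hj) hj'
  obtain ⟨B, u, hBF, hB, hu, hdual, hgen⟩ := exists_dual_vectors W F
  rw [← hB, ← Finset.card_compl]
  set m := Bᶜ.card with hm
  let e : Fin m ≃ (Bᶜ : Finset E) := (Finset.equivFinOfCardEq hm.symm).symm
  -- if all coordinates of `β` outside `B` vanish, then `β = 0`
  have hempty : {x ∈ stratum W F | ∀ s, x ∉ secondOpen K (e s : E)} = ∅ := by
    refine Set.eq_empty_of_forall_notMem ?_
    rintro x ⟨hx, hxs⟩
    obtain ⟨k, hk⟩ := exists_mem_secondOpen x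
    obtain ⟨κ, _, _, v, b, hv, hb, y, hinc, hvF, rfl⟩ :=
      exists_field_point_of_mem_stratum hx (Finset.mem_coe.not.1 hj) hk
    have hb0 : ∀ s, b (e s) = 0 := fun s => by
      have := hxs s
      rwa [pairPoint_mem_secondOpen, notMem_asIdeal_of_field, not_not] at this
    have hvF' : ∀ i ∈ F, v i = 0 := fun i hi => by
      have := (hvF i).not
      tauto
    rw [isIncident_iff_of_dual_vectors hu hdual hgen hinc.liesIn hvF'] at hinc
    by_cases hkB : k ∈ B
    · have := hinc k hkB
      rw [sum_compl_eq_sum B e] at this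
      simp only [hb0, mul_zero, Finset.sum_const_zero, add_zero, hb, mul_one] at this
      exact (hvF k).2 (Finset.disjoint_left.1 hBF hkB) this
    · obtain ⟨s, hs⟩ := e.surjective ⟨k, by simpa using hkB⟩
      have := hb0 s
      rw [hs, hb] at this
      exact one_ne_zero this
  rw [setClass_eq_sum_first isVariety_biprojOver (fun s => secondOpen K (e s : E))
    (isLocallyClosed_stratum W F), hempty, setClass_empty isVariety_biprojOver, add_zero,
    Finset.sum_congr rfl fun t _ => setClass_stratum_first (Finset.mem_coe.not.1 hj) hwj hw hwF hwu
      hwgen huniv hBF hu hdual hgen e t, ← Finset.mul_sum, hR,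
    ← Finset.sum_range_reflect, Finset.sum_range]

end Configuration

theorem Polynomial.X_pow_sub_one_divByMonic (m : ℕ) :
    ((X : ℤ[X]) ^ m - 1) /ₘ (X - C 1) = ∑ i ∈ Finset.range m, X ^ i := by
  rw [← geom_sum_mul, mul_comm, ← C_1, mul_divByMonic_cancel_left _ (monic_X_sub_C 1)]

theorem theorem1p2 {E : Type} [Fintype E] (W : Submodule ℂ (E → ℂ)) :
    GrothendieckRing.cls (Configuration.lambdaHom W) =
      ∑ F ∈ (Configuration.matroid W).properFlats,
        Polynomial.aeval (GrothendieckRing.lefschetz ℂ)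
            ((Configuration.matroid W).contract F).reducedCharPoly *
          Polynomial.aeval (GrothendieckRing.lefschetz ℂ)
            (((Polynomial.X : Polynomial ℤ) ^
                (Fintype.card E - ((Configuration.matroid W).delete F).eRank.toNat) - 1) /ₘ
              (Polynomial.X - Polynomial.C 1)) ∧
    ∃ p : Polynomial ℤ, GrothendieckRing.cls (Configuration.lambdaHom W) =
      Polynomial.aeval (GrothendieckRing.lefschetz ℂ) p := by
  classical
  -- the second statement follows from the first: the right hand side is a polynomial in `𝕃`
  refine (and_iff_left_of_imp fun h => ?_).2 ?_
  · simp only [← map_mul, ← map_sum] at h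
    exact ⟨_, h⟩
  rw [Configuration.cls_lambdaHom_eq_setClass,
    GrothendieckRing.setClass_eq_sum_powerset Configuration.isVariety_biprojOver
      (Configuration.firstOpen ℂ) Finset.univ
      Configuration.isClosed_incidenceSet.isLocallyClosed]
  have hmem : ∀ F : Finset E, (F : Set E) ∈ (Configuration.matroid W).properFlats ↔
      (Configuration.matroid W).IsFlat F ∧ (F : Set E) ≠ Set.univ := fun F => by
    rw [Matroid.properFlats, Set.Finite.mem_toFinset]
    rfl
  symm
  refine Finset.sum_of_injOn (fun F => (Set.toFinite F).toFinset) ?_ ?_ ?_ ?_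
  · intro F _ F' _ h
    simpa using h
  · intro F _
    simp
  · intro F _ hF
    refine (congrArg _ (Set.eq_empty_of_forall_notMem fun x hx => hF ?_)).trans
      (GrothendieckRing.setClass_empty Configuration.isVariety_biprojOver)
    exact ⟨F, (hmem F).2 (Configuration.isFlat_of_mem_stratum hx),
      Finset.coe_injective (Set.Finite.coe_toFinset _)⟩
  · intro F hF
    have hcoe : ((Set.toFinite F).toFinset : Set E) = F := Set.Finite.coe_toFinset _
    rw [← hcoe, hmem] at hF
    refine Eq.trans ?_ (Configuration.setClass_stratum hF.1 hF.2).symm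
    rw [hcoe, Polynomial.X_pow_sub_one_divByMonic, map_sum]
    simp

end
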